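/- Let $I(321)$ be the set of all involutions (permutations $\pi$ of $\{1,\dots,n\}$, with $\pi\circ\pi=\mathrm{id}$) that avoid the pattern $321$. A permutation is simple if the only nonempty contiguous sets of positions that it maps onto contiguous sets of values are the single positions and the whole set of positions. A permutation $\pi$ of length $n$ is an inflation of a permutation $\sigma$ of length $m$ if $\{1,\dots,n\}$ can be cut into $m$ nonempty consecutive blocks $B_1,\dots,B_m$ such that for $i\in B_a$, $j\in B_b$, $a\ne b$, one has $\pi(i)<\pi(j)$ if and only if $\sigma(a)<\sigma(b)$; it is proper if $m<n$. Let $\gamma=\sum_n\gamma_nx^n\in\mathbb{Q}[[x]]$, where $\gamma_n$ is the number of simple involutions in $I(321)$ of length $n$ for $n>2$ and $\gamma_n=0$ for $n\le 2$; let $\delta=\sum_n\delta_nx^n$, where $\delta_n$ is the number of involutions in $I(321)$ of length $n$ that are proper inflations of simple involutions of length greater than $2$; and let $\zeta=\gamma+\delta$. Then: 1. The power series $\gamma$ is algebraic over $\mathbb{Q}[x]$; it satisfies $(1+x^2)\gamma^2+(-1+x^2+2x^4)\gamma+x^6=0$, and $$\gamma=\frac{1-x^2-2x^4-\sqrt{1-2x^2-3x^4}}{2(1+x^2)},$$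 where $\sqrt{1-2x^2-3x^4}$ is the unique power series with constant term $1$ whose square is $1-2x^2-3x^4$. 2. One has $\gamma_k\ne0$ if and only if $k$ is even and $k\ge 6$, and $\gamma_{2n+2}=R_n$ for all $n\ge1$, where $R_n$ is the $n$-th Riordan number ($1,0,1,1,3,6,15,36,91,\dots$ for $n=0,1,2,\dots$), i.e. the number of Motzkin paths of length $n$ with no horizontal step at level $0$. 3. Both $\gamma$ and $\zeta$ contain only even powers of $x$, say $\gamma=g(x^2)$ and $\zeta=z(x^2)$ with power series $g,z$, and $$z(x^2)=g\Bigl(\frac{x^2}{1-x^2}\Bigr),\qquad g(x^2)=z\Bigl(\frac{x^2}{1+x^2}\Bigr).$$ -/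

import Mathlib

open scoped PowerSeries Polynomial

/-- `π` is an involution avoiding the pattern `321`: `π ∘ π = id` and there are no positions
`i < j < k` with `π i > π j > π k`. -/
def IsInv321 {n : ℕ} (π : Equiv.Perm (Fin n)) : Prop :=
  (∀ i, π (π i) = i) ∧ ¬ ∃ i j k : Fin n, i < j ∧ j < k ∧ π k < π j ∧ π j < π i

/-- The contiguous set of positions `[a, b]` is an interval of `π`: the set of values of `π` on it
is contiguous as well. -/
def IsPermInterval {n : ℕ} (π : Equiv.Perm (Fin n)) (a b : Fin n) : Prop :=
  ∃ c d : Fin n, π '' Set.Icc a b = Set.Icc c d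

/-- A permutation is simple if its only nonempty intervals are the single positions and the
whole set of positions. -/
def IsSimplePerm {n : ℕ} (π : Equiv.Perm (Fin n)) : Prop :=
  ∀ a b : Fin n, a ≤ b → IsPermInterval π a b → a = b ∨ Set.Icc a b = Set.univ

/-- `π` is an inflation `σ[α₁, …, αₘ]` of `σ`. The map `block` tells to which of the `m` blocks a
position belongs: the blocks are nonempty, they are consecutive sets of positions, and values in
different blocks compare as the corresponding values of `σ`. (Hence the values on each block are
contiguous too; `αᵢ` is the pattern of `π` on the block `i`, which can be arbitrary.) -/
def IsInflationOf {n m : ℕ} (π : Equiv.Perm (Fin n)) (σ : Equiv.Perm (Fin m)) : Prop :=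
  ∃ block : Fin n → Fin m, Monotone block ∧ Function.Surjective block ∧
    ∀ i j : Fin n, block i ≠ block j → (π i < π j ↔ σ (block i) < σ (block j))

/-- The simple involutions in `Av(321)` of length `n`, for `n > 2` (none for `n ≤ 2`). -/
def simpleInv321 (n : ℕ) : Set (Equiv.Perm (Fin n)) :=
  {π | 2 < n ∧ IsInv321 π ∧ IsSimplePerm π}

/-- The involutions in `Av(321)` of length `n` that are proper inflations of a simple involution
of length greater than `2`. -/
def inflatedInv321 (n : ℕ) : Set (Equiv.Perm (Fin n)) :=
  {π | IsInv321 π ∧ ∃ m : ℕ, 2 < m ∧ m < n ∧ ∃ σ : Equiv.Perm (Fin m),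
    IsSimplePerm σ ∧ (∀ i, σ (σ i) = i) ∧ IsInflationOf π σ}

/-- The generating function `∑ |S n| xⁿ` of a set of permutations given by its subsets `S n` of
permutations of length `n`. -/
noncomputable def permGenFun (S : (n : ℕ) → Set (Equiv.Perm (Fin n))) : ℚ⟦X⟧ :=
  PowerSeries.mk fun n => ((S n).ncard : ℚ)

/-- The generating function `γ` of the simple involutions in `Av(321)` of length greater
than `2`. -/
noncomputable def gammaGF : ℚ⟦X⟧ := permGenFun simpleInv321

/-- The generating function `δ` of the involutions in `Av(321)` that are proper inflations of
simple involutions of length greater than `2`. -/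
noncomputable def deltaGF : ℚ⟦X⟧ := permGenFun inflatedInv321

/-- The Motzkin paths of length `n` without horizontal steps at level `0`, given by their levels
`h 0, …, h n`: they start and end at level `0`, never go below it, each step changes the level by
at most `1`, and no step goes from level `0` to level `0`. -/
def riordanPaths (n : ℕ) : Set (Fin (n + 1) → ℕ) :=
  {h | h 0 = 0 ∧ h (Fin.last n) = 0 ∧
    ∀ i : Fin n, h i.succ ≤ h i.castSucc + 1 ∧ h i.castSucc ≤ h i.succ + 1 ∧
      ¬ (h i.castSucc = 0 ∧ h i.succ = 0)}

/-- The `n`-th Riordan number: `1, 0, 1, 1, 3, 6, 15, 36, 91, …`. -/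
noncomputable def riordanNumber (n : ℕ) : ℕ := (riordanPaths n).ncard

open PowerSeries

/-! Call adjacent positions with consecutive increasing values a bond; all other adjacent positions
form a break. A 321-avoiding involution of length greater than 2 is simple exactly when it is
indecomposable and has no bond (`mem_simpleInv321_iff`): a nontrivial interval with a descent splits
off a direct summand, and an increasing one contains a bond. Collapsing the maximal runs of bonds
gives a simple quotient as soon as there are two breaks. Hence `γ + δ` counts the indecomposable
ones with at least two breaks (`mem_simple_union_inflated_iff`).

An indecomposable 321-avoiding involution of length at least 2 has no fixed points, and it matches
its `k`-th opener `u k` with its `k`-th closer `d k`, for `k ≤ n`, so the length is `2 * n + 2`. For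
each `k < n` a letter records whether `d k`, `d (k + 1)` and whether `u k`, `u (k + 1)` fail to be
adjacent. The partial sums `α`, `β` of the two components determine how openers and closers
interleave, since `u j < d k` iff `β j ≤ α k` (`IsGapCount.u_lt_d_iff`). So the word determines the
involution, and indecomposability, `u (k + 1) < d k`, becomes `β (k + 1) ≤ α k`. This is the
condition for a Motzkin path without horizontal steps at level 0, with one extra letter `(false,
false)`, allowed at all levels, that marks bonds.

Simple permutations are the words without the extra letter, which gives the Riordan numbers; `γ + δ`
takes all words except the one made only of extra letters. Inserting extra letters is the
substitution `x ↦ x / (1 - x)`, and the quadratic equation comes from that of the Motzkin series. -/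

/-! ### Generating functions of the paths -/

/-- The number of lattice paths with `n` steps from level `0` to level `h` that stay at levels
`≥ 0`, with up, down and horizontal steps, no such horizontal step at level `0`, and with `e`
further kinds of horizontal steps, which are allowed at every level. -/
def pathCount (e : ℕ) : ℕ → ℕ → ℕ
  | 0, 0 => 1
  | 0, _ + 1 => 0
  | n + 1, 0 => pathCount e n 1 + e * pathCount e n 0
  | n + 1, h + 1 =>
    pathCount e n h + pathCount e n (h + 1) + pathCount e n (h + 2) + e * pathCount e n (h + 1)

/-- Removing the last step of a path gives this linear system, which determines its solution
coefficient by coefficient. So any explicit solution is the family of path series. -/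
theorem coeff_eq_pathCount (e : ℕ) (F : ℕ → ℚ⟦X⟧) (h0 : F 0 = 1 + X * (F 1 + (e : ℚ⟦X⟧) * F 0))
    (hs : ∀ h, F (h + 1) = X * (F h + F (h + 1) + F (h + 2) + (e : ℚ⟦X⟧) * F (h + 1)))
    (n h : ℕ) : coeff n (F h) = pathCount e n h := by
  have hc : ∀ (n : ℕ) (f : ℚ⟦X⟧), coeff n ((e : ℚ⟦X⟧) * f) = e * coeff n f := by
    intro n f
    rw [show (e : ℚ⟦X⟧) = C (e : ℚ) by simp, coeff_C_mul]
  induction n generalizing h with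
  | zero =>
    cases h with
    | zero => rw [h0]; simp [pathCount]
    | succ h => rw [hs]; simp [pathCount]
  | succ n ih =>
    cases h with
    | zero =>
      rw [h0, map_add, coeff_succ_X_mul, map_add, hc, ih, ih]
      simp [pathCount, coeff_one]
    | succ h =>
      rw [hs, coeff_succ_X_mul, map_add, map_add, map_add, hc, ih, ih, ih]
      simp [pathCount]

/-- The generating function of `pathCount e n 0`. -/
noncomputable def pathSeries (e : ℕ) : ℚ⟦X⟧ := PowerSeries.mk fun n => (pathCount e n 0 : ℚ)

theorem one_sub_X_mul_inv : (1 - X : ℚ⟦X⟧) * (1 - X)⁻¹ = 1 :=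
  PowerSeries.mul_inv_cancel _ (by simp)

theorem hasSubst_X_mul (f : ℚ⟦X⟧) : HasSubst (X * f : ℚ⟦X⟧) :=
  HasSubst.of_constantCoeff_zero' (by simp)

/-- The Motzkin equation `t = x (1 + t + t²)` is solvable. -/
theorem exists_motzkin_root : ∃ t : ℚ⟦X⟧, t = X * (1 + t + t ^ 2) := by
  obtain ⟨v, hv, hvs⟩ : ∃ v : ℚ⟦X⟧, (1 - X) * v = X ∧ HasSubst (v ^ 2) :=
    ⟨X * (1 - X)⁻¹, by rw [mul_left_comm, one_sub_X_mul_inv, mul_one],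
      HasSubst.of_constantCoeff_zero' (by simp)⟩
  have hcat := congrArg (PowerSeries.map (Nat.castRingHom ℚ)) catalanSeries_sq_mul_X_add_one
  simp only [map_add, map_mul, map_pow, PowerSeries.map_X, map_one] at hcat
  set c := PowerSeries.map (Nat.castRingHom ℚ) catalanSeries
  have h := congrArg (substAlgHom hvs) hcat
  simp only [map_add, map_mul, map_pow, map_one, substAlgHom_X] at h
  set d := substAlgHom hvs c
  -- With `v = X / (1 - X)` the equation reads `t = v (1 + t²)`. It is solved by `t = v d` with `d =
  -- 1 + v² d²`, the Catalan series at `v²`.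
  refine ⟨v * d, ?_⟩
  linear_combination (-v) * (1 - X) * h + (1 + d ^ 2 * v ^ 2) * hv

/-- The system has the geometric solution `R * t ^ h`: the equations at positive levels reduce to
the Motzkin equation for `t`, and the one at level 0 says `R = 1 / (1 - X t)`. -/
theorem exists_pathSeries_zero_eq :
    ∃ t : ℚ⟦X⟧, t = X * (1 + t + t ^ 2) ∧ (1 - X * t) * pathSeries 0 = 1 ∧
      ∀ n h, coeff n (pathSeries 0 * t ^ h) = pathCount 0 n h := by
  obtain ⟨t, ht⟩ := exists_motzkin_root
  have hu : (1 - X * t) * (1 - X * t)⁻¹ = 1 := PowerSeries.mul_inv_cancel _ (by simp)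
  set R := (1 - X * t)⁻¹ with hR
  have key : ∀ n h, coeff n (R * t ^ h) = pathCount 0 n h := by
    refine coeff_eq_pathCount 0 (fun h => R * t ^ h) ?_ ?_
    · push_cast; linear_combination hu
    · intro h; push_cast; linear_combination R * t ^ h * ht
  have hRp : R = pathSeries 0 := by
    ext n
    have := key n 0
    simpa [pathSeries] using this
  exact ⟨t, ht, hRp ▸ hu, fun n h => hRp ▸ key n h⟩

/-- Adding steps that are allowed everywhere amounts to the substitution `x ↦ x / (1 - x)`. -/
theorem pathSeries_one_eq :
    (1 - X) * pathSeries 1 = (pathSeries 0).subst (X * (1 - X)⁻¹ : ℚ⟦X⟧) := by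
  obtain ⟨t, ht, hu, hcoeff⟩ := exists_pathSeries_zero_eq
  have hv := one_sub_X_mul_inv
  have hs := hasSubst_X_mul (1 - X)⁻¹
  set w : ℚ⟦X⟧ := (1 - X)⁻¹ with hw
  have ht' := congrArg (substAlgHom hs) ht
  have hu' := congrArg (substAlgHom hs) hu
  simp only [map_add, map_mul, map_pow, map_one, map_sub, substAlgHom_X] at ht' hu'
  rw [← coe_substAlgHom hs]
  set R := substAlgHom hs (pathSeries 0)
  set s := substAlgHom hs t
  -- The substituted solution, multiplied by `w = 1 / (1 - X)`, solves the system with one free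
  -- horizontal step.
  have key : ∀ n h, coeff n (w * R * s ^ h) = pathCount 1 n h := by
    refine coeff_eq_pathCount 1 (fun h => w * R * s ^ h) ?_ ?_
    · push_cast
      linear_combination hu' + R * hv
    · intro h; push_cast
      linear_combination (R * s ^ h) * ht' + R * s ^ (h + 1) * hv
  have hRp : w * R = pathSeries 1 := by
    ext n
    have := key n 0
    simpa [pathSeries] using this
  rw [← hRp]
  linear_combination R * hv

/-- Eliminate `t` between `(1 - X t) R = 1` and the Motzkin equation; the nonzero factor `(1 - X
t)²` clears the denominators. -/
theorem pathSeries_zero_quadratic :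
    X * (1 + X) * pathSeries 0 ^ 2 - (1 + X) * pathSeries 0 + 1 = (0 : ℚ⟦X⟧) := by
  obtain ⟨t, ht, hu, -⟩ := exists_pathSeries_zero_eq
  set R := pathSeries 0
  have hne : (1 - X * t) ^ 2 ≠ 0 := fun h => by
    have : R ^ 2 * (1 - X * t) ^ 2 = 1 := by rw [← mul_pow, mul_comm R, hu, one_pow]
    rw [h, mul_zero] at this
    exact zero_ne_one this
  refine (mul_eq_zero.mp ?_).resolve_left hne
  linear_combination (X * (1 + X) * ((1 - X * t) * R + 1) - (1 + X) * (1 - X * t)) * hu - X * ht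

/-- Go up once and then stay at level 1. -/
theorem pathCount_zero_pos (n : ℕ) : 0 < pathCount 0 (n + 1) 1 := by
  induction n with
  | zero => simp [pathCount]
  | succ n ih => rw [pathCount, zero_add]; omega

theorem pathCount_zero_ne_zero_iff (n : ℕ) : pathCount 0 n 0 ≠ 0 ↔ n ≠ 1 := by
  match n with
  | 0 => simp [pathCount]
  | 1 => simp [pathCount]
  | n + 2 =>
    have := pathCount_zero_pos n
    simpa [pathCount] using this.ne'

/-! ### The series in `x²`: substitutions, algebraicity, square root -/

/-- The series `g` with `γ = g(x²)`. -/
noncomputable def gammaHalf : ℚ⟦X⟧ := X * (pathSeries 0 - 1)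

/-- The series `z` with `ζ = z(x²)`. -/
noncomputable def zetaHalf : ℚ⟦X⟧ := X * (pathSeries 1 - (1 - X)⁻¹)

/-- The subtracted 1 is the empty path, which belongs to the permutation `21`, too short to count.
-/
theorem coeff_gammaHalf_succ (n : ℕ) :
    coeff (n + 1) gammaHalf = if n = 0 then 0 else (pathCount 0 n 0 : ℚ) := by
  rw [gammaHalf, coeff_succ_X_mul, map_sub, pathSeries, coeff_mk, coeff_one]
  split_ifs with h
  · simp [h, pathCount]
  · simp

/-- The subtracted geometric series removes one word of each length, the one with free letters only;
its involution has a single break and is no inflation of a longer simple one. -/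
theorem coeff_zetaHalf_succ (n : ℕ) :
    coeff (n + 1) zetaHalf = (pathCount 1 n 0 : ℚ) - 1 := by
  have h : ((1 - X)⁻¹ : ℚ⟦X⟧) = PowerSeries.mk 1 := by
    rw [PowerSeries.inv_eq_iff_mul_eq_one (by simp)]
    exact PowerSeries.mk_one_mul_one_sub_eq_one ℚ
  rw [zetaHalf, coeff_succ_X_mul, map_sub, pathSeries, coeff_mk, h, coeff_mk]
  simp

theorem gammaHalf_quadratic :
    (1 + X) * gammaHalf ^ 2 + (-1 + X + 2 * X ^ 2) * gammaHalf + X ^ 3 = 0 := by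
  rw [gammaHalf]
  linear_combination X * pathSeries_zero_quadratic

/-- The factor `1 - X` in `pathSeries_one_eq` cancels the denominator that the outer `X` of
`gammaHalf` acquires. -/
theorem zetaHalf_eq : zetaHalf = gammaHalf.subst (X * (1 - X)⁻¹ : ℚ⟦X⟧) := by
  have hs := hasSubst_X_mul (1 - X)⁻¹
  have h := pathSeries_one_eq
  have hv := one_sub_X_mul_inv
  rw [gammaHalf, zetaHalf]
  rw [← coe_substAlgHom hs] at h ⊢
  rw [map_mul, map_sub, map_one, substAlgHom_X, ← h]
  linear_combination (- X * pathSeries 1) * hv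

theorem subst_mul_subst_inv {a f : ℚ⟦X⟧} (ha : HasSubst a) (hf : constantCoeff f ≠ 0) :
    f.subst a * f⁻¹.subst a = (1 : ℚ⟦X⟧) := by
  have h := congrArg (substAlgHom ha) (PowerSeries.mul_inv_cancel f hf)
  rwa [map_mul, map_one, coe_substAlgHom] at h

theorem subst_X_div_one_sub {a b : ℚ⟦X⟧} (ha : HasSubst a) (hb : (1 - a) * b = 1) :
    (X * (1 - X)⁻¹ : ℚ⟦X⟧).subst a = a * b := by
  have h := subst_mul_subst_inv ha (f := 1 - X) (by simp)
  rw [← coe_substAlgHom ha] at h ⊢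
  rw [map_sub, map_one, substAlgHom_X] at h
  rw [map_mul, substAlgHom_X]
  linear_combination (a * b) * h - (a * substAlgHom ha (1 - X : ℚ⟦X⟧)⁻¹) * hb

theorem zetaHalf_subst_eq {a b : ℚ⟦X⟧} (ha : HasSubst a) (hb : (1 - a) * b = 1) :
    zetaHalf.subst a = gammaHalf.subst (a * b) := by
  rw [zetaHalf_eq, subst_comp_subst_apply (hasSubst_X_mul _) ha, subst_X_div_one_sub ha hb]

theorem zeta_substitution :
    zetaHalf.subst (X ^ 2 : ℚ⟦X⟧) = gammaHalf.subst (X ^ 2 * (1 - X ^ 2)⁻¹ : ℚ⟦X⟧) :=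
  zetaHalf_subst_eq (HasSubst.X_pow two_ne_zero) (PowerSeries.mul_inv_cancel _ (by simp))

theorem gamma_substitution :
    gammaHalf.subst (X ^ 2 : ℚ⟦X⟧) = zetaHalf.subst (X ^ 2 * (1 + X ^ 2)⁻¹ : ℚ⟦X⟧) := by
  have h : (1 + X ^ 2 : ℚ⟦X⟧) * (1 + X ^ 2)⁻¹ = 1 := PowerSeries.mul_inv_cancel _ (by simp)
  -- For `a = X² / (1 + X²)` the inverse of `1 - a` is `1 + X²`, so `a * b` is `X²`.
  rw [zetaHalf_subst_eq (b := 1 + X ^ 2) (HasSubst.of_constantCoeff_zero' (by simp))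
    (by linear_combination (-X ^ 2) * h)]
  congr 1
  linear_combination (-X ^ 2) * h

theorem gammaHalf_subst_quadratic :
    (1 + X ^ 2) * gammaHalf.subst (X ^ 2 : ℚ⟦X⟧) ^ 2 +
      (-1 + X ^ 2 + 2 * X ^ 4) * gammaHalf.subst (X ^ 2 : ℚ⟦X⟧) + X ^ 6 = (0 : ℚ⟦X⟧) := by
  have hs : HasSubst (X ^ 2 : ℚ⟦X⟧) := HasSubst.X_pow two_ne_zero
  have h := congrArg (substAlgHom hs) gammaHalf_quadratic
  simp only [map_add, map_mul, map_pow, map_one, map_neg, map_ofNat, map_zero, substAlgHom_X,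
    coe_substAlgHom] at h
  linear_combination h

theorem constantCoeff_gammaHalf_subst :
    constantCoeff (gammaHalf.subst (X ^ 2 : ℚ⟦X⟧) : ℚ⟦X⟧) = 0 :=
  constantCoeff_subst_eq_zero (by rw [← PowerSeries.constantCoeff.eq_def]; simp) _ (by simp [gammaHalf])

theorem isAlgebraic_of_quadratic {f : ℚ⟦X⟧}
    (h : (1 + X ^ 2) * f ^ 2 + (-1 + X ^ 2 + 2 * X ^ 4) * f + X ^ 6 = 0) :
    IsAlgebraic ℚ[X] f := by
  refine ⟨.C (1 + .X ^ 2) * .X ^ 2 + .C (-1 + .X ^ 2 + 2 * .X ^ 4) * .X + .C (.X ^ 6), ?_, ?_⟩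
  · intro h0
    -- At value 2 of the outer variable and 0 of the inner one the polynomial is `4 - 2`.
    have := congrArg (Polynomial.eval 0) (congrArg (Polynomial.eval 2) h0)
    norm_num at this
  · have hX : algebraMap ℚ[X] ℚ⟦X⟧ .X = X := by
      rw [PowerSeries.algebraMap_apply']; simp
    simp only [map_add, map_mul, map_pow, map_one, map_neg, map_ofNat, Polynomial.aeval_C,
      Polynomial.aeval_X, hX]
    exact h

theorem eq_of_sq_eq_sq {s t : ℚ⟦X⟧} (hs : constantCoeff s = 1) (ht : constantCoeff t = 1)
    (h : s ^ 2 = t ^ 2) : s = t := by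
  rcases sq_eq_sq_iff_eq_or_eq_neg.mp h with h | h
  · exact h
  · rw [h, map_neg, ht] at hs
    norm_num at hs

theorem exists_sqrt_of_quadratic {f : ℚ⟦X⟧} (h0 : constantCoeff f = 0)
    (h : (1 + X ^ 2) * f ^ 2 + (-1 + X ^ 2 + 2 * X ^ 4) * f + X ^ 6 = 0) :
    ∃ s : ℚ⟦X⟧, constantCoeff s = 1 ∧ s ^ 2 = 1 - 2 * X ^ 2 - 3 * X ^ 4 ∧
      f = (1 - X ^ 2 - 2 * X ^ 4 - s) * (2 * (1 + X ^ 2))⁻¹ := by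
  have hc : constantCoeff (2 : ℚ⟦X⟧) = 2 := map_ofNat _ 2
  -- Completing the square: this is the root of the discriminant, and the vanishing constant term of
  -- `f` selects the branch.
  refine ⟨1 - X ^ 2 - 2 * X ^ 4 - 2 * (1 + X ^ 2) * f, by simp [h0], ?_, ?_⟩
  · linear_combination 4 * (1 + X ^ 2) * h
  · have := PowerSeries.mul_inv_cancel (2 * (1 + X ^ 2) : ℚ⟦X⟧) (by simp [hc])
    linear_combination (-f) * this

/-! ### Riordan paths -/

/-- The paths from level `0` to level `k` with the steps allowed in `riordanPaths`. -/
def riordanPathsTo (n k : ℕ) : Set (Fin (n + 1) → ℕ) :=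
  {h | h 0 = 0 ∧ h (Fin.last n) = k ∧
    ∀ i : Fin n, h i.succ ≤ h i.castSucc + 1 ∧ h i.castSucc ≤ h i.succ + 1 ∧
      ¬ (h i.castSucc = 0 ∧ h i.succ = 0)}

theorem snoc_mem_riordanPathsTo {n k l : ℕ} {h : Fin (n + 1) → ℕ} :
    (Fin.snoc h k : Fin (n + 2) → ℕ) ∈ riordanPathsTo (n + 1) l ↔
      k = l ∧ h ∈ riordanPathsTo n (h (Fin.last n)) ∧ k ≤ h (Fin.last n) + 1 ∧
        h (Fin.last n) ≤ k + 1 ∧ ¬ (h (Fin.last n) = 0 ∧ k = 0) := by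
  have h0 : (Fin.snoc h k : Fin (n + 2) → ℕ) 0 = h 0 := by
    rw [← Fin.castSucc_zero, Fin.snoc_castSucc (α := fun _ => ℕ)]
  simp only [riordanPathsTo, Set.mem_ofPred_eq, h0, Fin.snoc_last, Fin.forall_fin_succ',
    Fin.succ_castSucc, Fin.snoc_castSucc (α := fun _ => ℕ), Fin.succ_last]
  tauto

/-- Cutting off the last step; the end level has to vary for the recursion of `pathCount` to appear.
-/
theorem riordanPathsTo_succ (n k : ℕ) :
    riordanPathsTo (n + 1) k = (fun h => (Fin.snoc h k : Fin (n + 2) → ℕ)) ''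
      {h | h ∈ riordanPathsTo n (h (Fin.last n)) ∧ k ≤ h (Fin.last n) + 1 ∧
        h (Fin.last n) ≤ k + 1 ∧ ¬ (h (Fin.last n) = 0 ∧ k = 0)} := by
  ext h
  constructor
  · intro hh
    have hk : h (Fin.last (n + 1)) = k := hh.2.1
    have e : (Fin.snoc (Fin.init h) k : Fin (n + 2) → ℕ) = h := by rw [← hk, Fin.snoc_init_self]
    exact ⟨Fin.init h, (snoc_mem_riordanPathsTo.mp (e.symm ▸ hh)).2, e⟩
  · rintro ⟨h, hh, rfl⟩
    exact snoc_mem_riordanPathsTo.mpr ⟨rfl, hh⟩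

theorem snoc_const_injective {α : Type*} (n : ℕ) (k : α) :
    Function.Injective fun h : Fin n → α => (Fin.snoc h k : Fin (n + 1) → α) := by
  intro f g hfg
  have := congrArg Fin.init hfg
  simpa using this

theorem riordanPathsTo_disjoint {n k l : ℕ} (hkl : k ≠ l) :
    Disjoint (riordanPathsTo n k) (riordanPathsTo n l) :=
  Set.disjoint_left.mpr fun _ h h' => hkl (h.2.1.symm.trans h'.2.1)

theorem riordanPathsTo_finite_and_ncard (n : ℕ) :
    ∀ k, (riordanPathsTo n k).Finite ∧ (riordanPathsTo n k).ncard = pathCount 0 n k := by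
  induction n with
  | zero =>
    intro k
    cases k with
    | zero =>
      have : riordanPathsTo 0 0 = {fun _ => 0} := by
        ext h
        simp [riordanPathsTo, funext_iff, Fin.forall_fin_one]
      rw [this]
      simp [pathCount]
    | succ k =>
      have : riordanPathsTo 0 (k + 1) = ∅ := by
        ext h
        simp only [riordanPathsTo, Set.mem_ofPred_eq, Set.mem_empty_iff_false, iff_false]
        rintro ⟨h0, h1, -⟩
        change h 0 = k + 1 at h1
        omega
      rw [this]
      simp [pathCount]
  | succ n ih =>
    intro k
    rw [riordanPathsTo_succ]
    cases k with
    | zero =>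
      have : {h | h ∈ riordanPathsTo n (h (Fin.last n)) ∧ 0 ≤ h (Fin.last n) + 1 ∧
          h (Fin.last n) ≤ 0 + 1 ∧ ¬ (h (Fin.last n) = 0 ∧ 0 = 0)} = riordanPathsTo n 1 := by
        ext h
        constructor
        · rintro ⟨h1, h2, h3, h4⟩
          rwa [show h (Fin.last n) = 1 by omega] at h1
        · intro hh
          have := hh.2.1
          exact ⟨this.symm ▸ hh, by omega, by omega, by omega⟩
      rw [this]
      refine ⟨(ih 1).1.image _, ?_⟩
      rw [Set.ncard_image_of_injective _ (snoc_const_injective _ _), (ih 1).2]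
      simp [pathCount]
    | succ k =>
      have : {h | h ∈ riordanPathsTo n (h (Fin.last n)) ∧ k + 1 ≤ h (Fin.last n) + 1 ∧
          h (Fin.last n) ≤ k + 1 + 1 ∧ ¬ (h (Fin.last n) = 0 ∧ k + 1 = 0)} =
          riordanPathsTo n k ∪ riordanPathsTo n (k + 1) ∪ riordanPathsTo n (k + 2) := by
        ext h
        constructor
        · rintro ⟨h1, h2, h3, h4⟩
          obtain h | h | h : h (Fin.last n) = k ∨ h (Fin.last n) = k + 1 ∨
            h (Fin.last n) = k + 2 := by omega
          all_goals rw [h] at h1; simp [h1]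
        · rintro ((hh | hh) | hh) <;>
          · have := hh.2.1
            exact ⟨this.symm ▸ hh, by omega, by omega, by omega⟩
      rw [this]
      refine ⟨(((ih k).1.union (ih (k + 1)).1).union (ih (k + 2)).1).image _, ?_⟩
      rw [Set.ncard_image_of_injective _ (snoc_const_injective _ _),
        Set.ncard_union_eq (Set.disjoint_union_left.mpr ⟨riordanPathsTo_disjoint (by omega),
          riordanPathsTo_disjoint (by omega)⟩) ((ih k).1.union (ih (k + 1)).1) (ih (k + 2)).1,
        Set.ncard_union_eq (riordanPathsTo_disjoint (by omega)) (ih k).1 (ih (k + 1)).1,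
        (ih _).2, (ih _).2, (ih _).2]
      simp [pathCount]

theorem riordanNumber_eq_pathCount (n : ℕ) : riordanNumber n = pathCount 0 n 0 :=
  (riordanPathsTo_finite_and_ncard n 0).2

/-! ### Simple permutations through breaks -/

/-- `π` is not a direct sum: no proper nonempty initial set of positions has only values below
those at the remaining positions. -/
def IsIndecomposable {n : ℕ} (π : Equiv.Perm (Fin n)) : Prop :=
  ∀ s, 0 < s → s < n → ∃ a b : Fin n, a.val < s ∧ s ≤ b.val ∧ π b < π a

/-- The positions `i` and `i + 1` do not carry consecutive increasing values. -/
def IsBreak {n : ℕ} (π : Equiv.Perm (Fin n)) (i : ℕ) : Prop :=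
  ∃ a b : Fin n, a.val = i ∧ b.val = i + 1 ∧ (π b).val ≠ (π a).val + 1

theorem isBreak_of {n : ℕ} {π : Equiv.Perm (Fin n)} {a b : Fin n} (h : b.val = a.val + 1)
    (hπ : (π b).val ≠ (π a).val + 1) : IsBreak π a := ⟨a, b, rfl, h, hπ⟩

theorem IsBreak.ne {n : ℕ} {π : Equiv.Perm (Fin n)} {a b : Fin n} (hb : IsBreak π a)
    (h : b.val = a.val + 1) : (π b).val ≠ (π a).val + 1 := by
  obtain ⟨a', b', h1, h2, h3⟩ := hb
  obtain rfl : a' = a := Fin.ext h1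
  obtain rfl : b' = b := Fin.ext (by omega)
  exact h3

theorem IsBreak.lt {n : ℕ} {π : Equiv.Perm (Fin n)} {i : ℕ} (hb : IsBreak π i) : i + 1 < n := by
  obtain ⟨a, b, h1, h2, h3⟩ := hb
  omega

theorem exists_eq_Icc_of_between {n : ℕ} {S : Set (Fin n)} (hne : S.Nonempty)
    (h : ∀ x ∈ S, ∀ y ∈ S, ∀ z, x < z → z < y → z ∈ S) : ∃ c d, S = Set.Icc c d := by
  obtain ⟨c, hc, hc'⟩ := Set.exists_min_image S id S.toFinite hne
  obtain ⟨d, hd, hd'⟩ := Set.exists_max_image S id S.toFinite hne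
  refine ⟨c, d, Set.Subset.antisymm (fun x hx => ⟨hc' x hx, hd' x hx⟩) fun z hz => ?_⟩
  rcases hz.1.eq_or_lt with rfl | h1
  · exact hc
  rcases hz.2.eq_or_lt with rfl | h2
  · exact hd
  exact h c hc d hd z h1 h2

theorem isPermInterval_of {n : ℕ} {π : Equiv.Perm (Fin n)} {a b : Fin n} (hab : a ≤ b)
    (h : ∀ x ∈ Set.Icc a b, ∀ y ∈ Set.Icc a b, ∀ z, π x < π z → π z < π y → z ∈ Set.Icc a b) :
    IsPermInterval π a b := by
  refine exists_eq_Icc_of_between ⟨π a, a, ⟨le_rfl, hab⟩, rfl⟩ ?_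
  rintro _ ⟨x, hx, rfl⟩ _ ⟨y, hy, rfl⟩ z h1 h2
  refine ⟨π.symm z, h x hx y hy _ ?_ ?_, by simp⟩ <;> simpa

/-- If `π` were a direct sum cut at `s`, both summands would be intervals. The first is nontrivial
unless `s = 1`, and then the second is, because `2 < n`. -/
theorem IsSimplePerm.isIndecomposable {n : ℕ} {π : Equiv.Perm (Fin n)} (hπ : IsSimplePerm π)
    (hn : 2 < n) : IsIndecomposable π := by
  intro s hs hsn
  by_contra! hcon
  have hlt : ∀ a b : Fin n, a.val < s → s ≤ b.val → π a < π b := fun a b ha hb =>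
    lt_of_le_of_ne (hcon a b ha hb) fun h => by
      have := π.injective h
      subst this
      omega
  by_cases h1 : s = 1
  · have hint : IsPermInterval π ⟨1, by omega⟩ ⟨n - 1, by omega⟩ := by
      refine isPermInterval_of (by simp [Fin.le_def]; omega) fun x hx y hy z h1 h2 => ?_
      by_contra hz
      simp only [Set.mem_Icc, Fin.le_def] at hx hz
      have := hlt z x (by omega) (by omega)
      exact lt_asymm this h1
    rcases hπ _ _ (by simp [Fin.le_def]; omega) hint with h | h
    · simp only [Fin.ext_iff] at h
      omega
    · have : (⟨0, by omega⟩ : Fin n) ∈ Set.Icc (⟨1, by omega⟩ : Fin n) ⟨n - 1, by omega⟩ :=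
        h ▸ Set.mem_univ _
      simp [Fin.le_def] at this
  · have hint : IsPermInterval π ⟨0, by omega⟩ ⟨s - 1, by omega⟩ := by
      refine isPermInterval_of (by simp [Fin.le_def]) fun x hx y hy z h1 h2 => ?_
      by_contra hz
      simp only [Set.mem_Icc, Fin.le_def] at hy hz
      have := hlt y z (by omega) (by omega)
      exact lt_asymm this h2
    rcases hπ _ _ (by simp [Fin.le_def]) hint with h | h
    · simp only [Fin.ext_iff] at h
      omega
    · have : (⟨s, by omega⟩ : Fin n) ∈ Set.Icc (⟨0, by omega⟩ : Fin n) ⟨s - 1, by omega⟩ :=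
        h ▸ Set.mem_univ _
      simp [Fin.le_def] at this
      omega

theorem IsSimplePerm.isBreak {n : ℕ} {π : Equiv.Perm (Fin n)} (hπ : IsSimplePerm π)
    (hn : 2 < n) {i : ℕ} (hi : i + 1 < n) : IsBreak π i := by
  by_contra hb
  have hbond : (π ⟨i + 1, hi⟩).val = (π ⟨i, by omega⟩).val + 1 := by
    by_contra h
    exact hb ⟨_, _, rfl, rfl, h⟩
  have hint : IsPermInterval π ⟨i, by omega⟩ ⟨i + 1, hi⟩ := by
    refine isPermInterval_of (by simp [Fin.le_def]) fun x hx y hy z h1 h2 => ?_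
    have hcase : ∀ x ∈ Set.Icc (⟨i, by omega⟩ : Fin n) ⟨i + 1, hi⟩,
        x = ⟨i, by omega⟩ ∨ x = ⟨i + 1, hi⟩ := by
      intro x hx
      simp only [Set.mem_Icc, Fin.le_def] at hx
      simp only [Fin.ext_iff]
      omega
    rw [Fin.lt_def] at h1 h2
    rcases hcase x hx with h | h <;> rcases hcase y hy with h' | h' <;> rw [h] at h1 <;>
      rw [h'] at h2 <;> omega
  rcases hπ _ _ (by simp [Fin.le_def]) hint with h | h
  · simp at h
  · obtain ⟨k, hk, hk'⟩ : ∃ k, k < n ∧ (k < i ∨ i + 1 < k) := by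
      by_cases h0 : i = 0
      · exact ⟨2, hn, by omega⟩
      · exact ⟨0, by omega, by omega⟩
    have : (⟨k, hk⟩ : Fin n) ∈ Set.Icc (⟨i, by omega⟩ : Fin n) ⟨i + 1, hi⟩ :=
      h ▸ Set.mem_univ _
    simp [Fin.le_def] at this
    omega

/-- Consider a nontrivial interval. If it contains a descent, 321-avoidance forces everything to its
left below it and everything to its right above it, so `π` decomposes. If `π` increases on it, its
first two values are consecutive, as any value in between would also be taken in the interval. -/
theorem isSimplePerm_of {n : ℕ} {π : Equiv.Perm (Fin n)} (h321 : IsInv321 π)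
    (hind : IsIndecomposable π) (hb : ∀ i, i + 1 < n → IsBreak π i) : IsSimplePerm π := by
  rintro a b hab ⟨c, d, hcd⟩
  by_contra! hcon
  obtain ⟨hne, huniv⟩ := hcon
  have hab' : a < b := lt_of_le_of_ne hab hne
  have hmem : ∀ z, z ∈ Set.Icc a b ↔ π z ∈ Set.Icc c d := fun z => by
    rw [← hcd, π.injective.mem_set_image]
  simp only [Set.mem_Icc] at hmem
  by_cases hdesc : ∃ x y, a ≤ x ∧ x < y ∧ y ≤ b ∧ π y < π x
  · obtain ⟨x, y, hax, hxy, hyb, hyx⟩ := hdesc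
    have hx := (hmem x).mp ⟨hax, hxy.le.trans hyb⟩
    have hy := (hmem y).mp ⟨hax.trans hxy.le, hyb⟩
    have hlow : ∀ z, z < a → π z < c := fun z hz => by
      by_contra! hc
      have : d < π z := by
        by_contra! hd
        exact absurd ((hmem z).mpr ⟨hc, hd⟩).1 (not_le.mpr hz)
      exact h321.2 ⟨z, x, y, hz.trans_le hax, hxy, hyx, hx.2.trans_lt this⟩
    have hhigh : ∀ z, b < z → d < π z := fun z hz => by
      by_contra! hd
      have : π z < c := by
        by_contra! hc
        exact absurd ((hmem z).mpr ⟨hc, hd⟩).2 (not_le.mpr hz)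
      exact h321.2 ⟨x, y, z, hxy, hyb.trans_lt hz, this.trans_le hy.1, hyx⟩
    by_cases ha : a.val = 0
    · by_cases hbn : b.val + 1 < n
      · obtain ⟨p, q, hp, hq, hpq⟩ := hind (b.val + 1) (by omega) hbn
        have h1 := (hmem p).mp ⟨by rw [Fin.le_def]; omega, by rw [Fin.le_def]; omega⟩
        exact absurd (hhigh q hq) (not_lt.mpr (hpq.le.trans h1.2))
      · refine huniv (Set.eq_univ_of_forall fun z => ⟨?_, ?_⟩) <;> rw [Fin.le_def] <;> omega
    · obtain ⟨p, q, hp, hq, hpq⟩ := hind a.val (by omega) a.isLt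
      have h1 := hlow p hp
      have h2 : q ≤ b := by
        by_contra! h
        have := hhigh q h
        exact absurd (hpq.trans h1) (not_lt.mpr ((hx.1.trans hx.2).trans this.le))
      exact absurd (hpq.trans h1) (not_lt.mpr ((hmem q).mp ⟨hq, h2⟩).1)
  · push Not at hdesc
    have hmono : ∀ x y, a ≤ x → x ≤ y → y ≤ b → π x ≤ π y := fun x y h1 h2 h3 => by
      rcases h2.eq_or_lt with rfl | h2
      · exact le_rfl
      · exact hdesc x y h1 h2 h3
    rw [Fin.lt_def] at hab'
    set a' : Fin n := ⟨a.val + 1, by omega⟩ with ha'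
    have haa' : a ≤ a' := by rw [Fin.le_def, ha']; simp
    have hab'' : a' ≤ b := by rw [Fin.le_def, ha']; simpa using hab'
    refine (hb a.val (by omega)).ne (b := a') rfl ?_
    have hlt : π a < π a' := lt_of_le_of_ne (hmono _ _ le_rfl haa' hab'') fun h => by
      have := π.injective h
      rw [Fin.ext_iff, ha'] at this
      simp at this
    by_contra hne'
    rw [Fin.lt_def] at hlt
    have hw : (π a).val + 1 < n := by omega
    -- The value just above `π a` lies between two values of the interval, so its position is in the
    -- interval too; it fits neither at `a` nor from `a + 1` on.
    set w : Fin n := ⟨(π a).val + 1, hw⟩ with hwdef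
    have hzw : π (π.symm w) = w := by simp
    have h1 : π a < w := by rw [Fin.lt_def, hwdef]; simp
    have h2 : w < π a' := by rw [Fin.lt_def, hwdef]; change (π a).val + 1 < _; omega
    have hz := (hmem (π.symm w)).mpr (by
      rw [hzw]
      exact ⟨((hmem a).mp ⟨le_rfl, hab⟩).1.trans h1.le,
        h2.le.trans ((hmem a').mp ⟨haa', hab''⟩).2⟩)
    rcases le_or_gt (π.symm w) a with h | h
    · have := hmono _ _ hz.1 h hab
      rw [hzw] at this
      exact absurd this (not_le.mpr h1)
    · have := hmono a' (π.symm w) haa' (by rw [Fin.lt_def] at h; rw [Fin.le_def, ha']; exact h) hz.2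
      rw [hzw] at this
      exact absurd this (not_le.mpr h2)

theorem mem_simpleInv321_iff {n : ℕ} {π : Equiv.Perm (Fin n)} :
    π ∈ simpleInv321 n ↔
      2 < n ∧ IsInv321 π ∧ IsIndecomposable π ∧ ∀ i, i + 1 < n → IsBreak π i :=
  ⟨fun ⟨hn, h, hs⟩ => ⟨hn, h, hs.isIndecomposable hn, fun _ hi => hs.isBreak hn hi⟩,
    fun ⟨hn, h, hi, hb⟩ => ⟨hn, h, isSimplePerm_of h hi hb⟩⟩

/-! ### Inflations of simple permutations -/

/-- A cut `s` of the positions induces a cut `t` of the blocks such that every block below `t` meets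
the positions before `s` and every other block meets the rest. An inversion of `σ` across `t` then
lifts to one across `s`. -/
theorem IsInflationOf.isIndecomposable {n m : ℕ} {π : Equiv.Perm (Fin n)}
    {σ : Equiv.Perm (Fin m)} (h : IsInflationOf π σ) (hm : 1 < m) (hσ : IsIndecomposable σ) :
    IsIndecomposable π := by
  obtain ⟨block, hmono, hsurj, hord⟩ := h
  intro s hs hsn
  by_contra! hcon
  obtain ⟨t, ht0, htm, htl, htr⟩ : ∃ t, 0 < t ∧ t < m ∧
      (∀ c : Fin m, c.val < t → ∃ i, block i = c ∧ i.val < s) ∧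
      (∀ c : Fin m, t ≤ c.val → ∃ i, block i = c ∧ s ≤ i.val) := by
    -- The cut `t` is the block of position `s`. If that is block 0, which would give an empty left
    -- side, take `t = 1`: position `s - 1` lies in block 0 as well.
    by_cases h0 : (block ⟨s, hsn⟩).val = 0
    · refine ⟨1, by omega, hm, fun c hc => ⟨⟨s - 1, by omega⟩, ?_, by simp; omega⟩,
        fun c hc => ?_⟩
      · have : block ⟨s - 1, by omega⟩ ≤ block ⟨s, hsn⟩ := hmono (by simp [Fin.le_def])
        rw [Fin.le_def] at this
        exact Fin.ext (by omega)
      · obtain ⟨i, rfl⟩ := hsurj c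
        refine ⟨i, rfl, ?_⟩
        by_contra! hi
        have : block i ≤ block ⟨s, hsn⟩ := hmono (by rw [Fin.le_def]; exact hi.le)
        rw [Fin.le_def] at this
        omega
    · refine ⟨(block ⟨s, hsn⟩).val, by omega, Fin.isLt _, fun c hc => ?_, fun c hc => ?_⟩
      · obtain ⟨i, rfl⟩ := hsurj c
        refine ⟨i, rfl, ?_⟩
        by_contra! hi
        have : block ⟨s, hsn⟩ ≤ block i := hmono (by rw [Fin.le_def]; exact hi)
        rw [Fin.le_def] at this
        omega
      · rcases hc.eq_or_lt with hc | hc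
        · exact ⟨⟨s, hsn⟩, Fin.ext hc, le_rfl⟩
        · obtain ⟨i, rfl⟩ := hsurj c
          refine ⟨i, rfl, ?_⟩
          by_contra! hi
          have : block i ≤ block ⟨s, hsn⟩ := hmono (by rw [Fin.le_def]; exact hi.le)
          rw [Fin.le_def] at this
          omega
  obtain ⟨a, b, ha, hb, hab⟩ := hσ t ht0 htm
  obtain ⟨i, rfl, hi⟩ := htl a ha
  obtain ⟨j, rfl, hj⟩ := htr b hb
  have := (hord j i (fun h => by rw [h] at hb; omega)).mpr hab
  exact absurd this (not_lt.mpr (hcon i j hi hj))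

/-- Every boundary between consecutive blocks is a break, and `2 < m` gives two boundaries. A bond
there would make `σ` increase across the boundary by more than 1, since `σ` has only breaks; the
block carrying the next value of `σ` would then have values strictly inside the bond. -/
theorem IsInflationOf.exists_isBreak {n m : ℕ} {π : Equiv.Perm (Fin n)}
    {σ : Equiv.Perm (Fin m)} (h : IsInflationOf π σ) (hm : 2 < m) (hσ : IsSimplePerm σ) :
    ∃ i j, i < j ∧ IsBreak π i ∧ IsBreak π j := by
  obtain ⟨block, hmono, hsurj, hord⟩ := h
  have key : ∀ c (hc : c + 1 < m), ∃ a b : Fin n, b.val = a.val + 1 ∧ (block a).val = c ∧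
      (block b).val = c + 1 ∧ IsBreak π a := by
    intro c hc
    obtain ⟨a, ha, hmax⟩ := Set.exists_max_image {i | block i = ⟨c, by omega⟩} id
      (Set.toFinite _) (by obtain ⟨i, hi⟩ := hsurj ⟨c, by omega⟩; exact ⟨i, hi⟩)
    obtain ⟨j, hj⟩ := hsurj ⟨c + 1, hc⟩
    have ha' : (block a).val = c := congrArg Fin.val ha
    have haj : a < j := by
      by_contra! h
      have := hmono h
      rw [hj, Fin.le_def] at this
      simp only at this
      omega
    rw [Fin.lt_def] at haj
    set b : Fin n := ⟨a.val + 1, by omega⟩ with hb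
    have h1 : block a ≤ block b := hmono (by simp [Fin.le_def, hb])
    have h2 : block b ≤ block j := hmono (by rw [Fin.le_def, hb]; exact haj)
    have h3 : (block b).val ≠ c := fun h => by
      have := hmax b (Fin.ext h)
      simp [Fin.le_def, hb] at this
    rw [hj] at h2
    rw [Fin.le_def] at h1 h2
    simp only at h2
    have hbc : (block b).val = c + 1 := by omega
    refine ⟨a, b, rfl, ha', hbc, isBreak_of (a := a) (b := b) rfl fun hbond => ?_⟩
    have hσb := hσ.isBreak hm (i := (block a).val) (by omega)
    have hne := hσb.ne (b := block b) (by omega)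
    have hlt := (hord a b (fun h => by rw [h] at ha'; omega)).mp (by rw [Fin.lt_def]; omega)
    rw [Fin.lt_def] at hlt
    obtain ⟨z, hz⟩ := hsurj (σ.symm ⟨(σ (block a)).val + 1, by omega⟩)
    have hz' : σ (block z) = ⟨(σ (block a)).val + 1, by omega⟩ := by simp [hz]
    have hza : π a < π z := (hord a z (fun h => by
      rw [← h] at hz'; simp [Fin.ext_iff] at hz')).mpr (by rw [hz', Fin.lt_def]; simp)
    have hzb : π z < π b := (hord z b (fun h => by
      rw [h] at hz'; rw [hz'] at hne; simp at hne)).mpr (by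
        rw [hz', Fin.lt_def]; change (σ (block a)).val + 1 < _; omega)
    rw [Fin.lt_def] at hza hzb
    omega
  obtain ⟨a, b, h1, h2, h3, h4⟩ := key 0 (by omega)
  obtain ⟨a', b', h1', h2', h3', h4'⟩ := key 1 (by omega)
  refine ⟨a, a', ?_, h4, h4'⟩
  by_contra! h
  have : block a' ≤ block a := hmono h
  rw [Fin.le_def] at this
  omega

/-- In a proper inflation some block has two positions; it is an interval, and not everything
because there are other blocks. -/
theorem simpleInv321_disjoint_inflatedInv321 (n : ℕ) :
    Disjoint (simpleInv321 n) (inflatedInv321 n) := by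
  refine Set.disjoint_left.mpr ?_
  rintro π ⟨hn, -, hs⟩ ⟨-, m, hm, hmn, σ, -, -, block, hmono, hsurj, hord⟩
  obtain ⟨x, y, hxy, hb⟩ := Fintype.exists_ne_map_eq_of_card_lt block (by simpa using hmn)
  set S : Set (Fin n) := {i | block i = block x} with hS
  obtain ⟨a, b, hab⟩ := exists_eq_Icc_of_between (S := S) ⟨x, rfl⟩ (by
    intro i hi j hj z hiz hzj
    exact le_antisymm ((hmono hzj.le).trans_eq hj) ((hmono hiz.le).trans_eq' hi))
  have hx : x ∈ Set.Icc a b := hab ▸ (rfl : block x = block x)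
  have hy : y ∈ Set.Icc a b := hab ▸ hb.symm
  rcases hs a b (hx.1.trans hx.2) (isPermInterval_of (hx.1.trans hx.2) (by
    rw [← hab]
    intro i hi j hj z h1 h2
    by_contra hz
    have hi' : block i = block x := hi
    have hj' : block j = block x := hj
    have e1 := (hord i z (fun h => hz (h.symm.trans hi'))).mp h1
    have e2 := (hord z j (fun h => hz (h.trans hj'))).mp h2
    rw [hi'] at e1
    rw [hj'] at e2
    exact lt_asymm e1 e2)) with h | h
  · subst h
    exact hxy ((le_antisymm hx.2 hx.1).trans (le_antisymm hy.1 hy.2))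
  · obtain ⟨i, hi⟩ := hsurj ⟨0, by omega⟩
    obtain ⟨j, hj⟩ := hsurj ⟨1, by omega⟩
    have hi' : i ∈ S := by rw [hab, h]; trivial
    have hj' : j ∈ S := by rw [hab, h]; trivial
    have := (hi.symm.trans hi').trans (hj.symm.trans hj').symm
    simp at this

/-! ### Collapsing runs of bonds to a simple quotient -/

theorem exists_step_of_lt {f : ℕ → ℕ} (h : ∀ i, f (i + 1) ≤ f i + 1) {s N : ℕ} (h0 : f 0 ≤ s)
    (hs : s < f N) : ∃ i < N, f i = s ∧ f (i + 1) = s + 1 := by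
  induction N with
  | zero => omega
  | succ N ih =>
    by_cases hN : s < f N
    · obtain ⟨i, hi, h1⟩ := ih hN
      exact ⟨i, by omega, h1⟩
    · have := h N
      exact ⟨N, by omega, by omega, by omega⟩

section Quotient

open Classical in
/-- The number of breaks of `π` below `i`: the index of the maximal increasing run of consecutive
values to which the position `i` belongs. -/
noncomputable def runIndex {n : ℕ} (π : Equiv.Perm (Fin n)) (i : ℕ) : ℕ := Nat.count (IsBreak π) i

variable {n : ℕ} {π : Equiv.Perm (Fin n)}

theorem runIndex_zero : runIndex π 0 = 0 := by simp [runIndex]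

theorem runIndex_mono : Monotone (runIndex π) := by
  classical exact Nat.count_monotone _

theorem runIndex_succ_of_isBreak {i : ℕ} (h : IsBreak π i) :
    runIndex π (i + 1) = runIndex π i + 1 := by
  classical
  simp [runIndex, Nat.count_succ, h]

theorem runIndex_succ_of_not_isBreak {i : ℕ} (h : ¬ IsBreak π i) :
    runIndex π (i + 1) = runIndex π i := by
  classical
  simp [runIndex, Nat.count_succ, h]

theorem runIndex_succ_le (i : ℕ) : runIndex π (i + 1) ≤ runIndex π i + 1 := by
  by_cases h : IsBreak π i
  · exact (runIndex_succ_of_isBreak h).le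
  · rw [runIndex_succ_of_not_isBreak h]; omega

/-- On positions with the same run index the involution is a translation, and it preserves the
relation of having the same run index. -/
theorem eq_add_of_runIndex_eq (hinv : ∀ i, π (π i) = i) :
    ∀ (k : ℕ) (i j : Fin n), j.val = i.val + k → runIndex π i = runIndex π j →
      (π j).val = (π i).val + k ∧ runIndex π (π i) = runIndex π (π j) := by
  intro k
  induction k with
  | zero =>
    intro i j hij _
    obtain rfl : j = i := Fin.ext (by omega)
    exact ⟨by omega, rfl⟩
  | succ k ih =>
    intro i j hij hr
    set l : Fin n := ⟨i.val + k, by omega⟩ with hl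
    have hjl : j.val = l.val + 1 := by simp [hl]; omega
    have h1 : runIndex π i ≤ runIndex π l := runIndex_mono (by simp [hl])
    have h2 : runIndex π l ≤ runIndex π j := runIndex_mono (by omega)
    obtain ⟨h3, h4⟩ := ih i l rfl (by omega)
    have hnb : ¬ IsBreak π l := fun h => by
      have := runIndex_succ_of_isBreak h
      rw [← hjl] at this
      omega
    have hπ : (π j).val = (π l).val + 1 := by
      by_contra h
      exact hnb (isBreak_of hjl h)
    -- An involution is its own inverse, so exchanging positions and values turns a bond into a
    -- bond.
    have hnb' : ¬ IsBreak π (π l) := fun h => by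
      have := h.ne hπ
      rw [hinv, hinv] at this
      exact this hjl
    refine ⟨by omega, ?_⟩
    rw [h4, hπ, runIndex_succ_of_not_isBreak hnb']

theorem runIndex_apply_eq (hinv : ∀ i, π (π i) = i) {i j : Fin n}
    (h : runIndex π i = runIndex π j) : runIndex π (π i) = runIndex π (π j) := by
  rcases le_total i.val j.val with hij | hij
  · exact (eq_add_of_runIndex_eq hinv (j.val - i.val) i j (by omega) h).2
  · exact (eq_add_of_runIndex_eq hinv (i.val - j.val) j i (by omega) h.symm).2.symm

/-- This excludes bonds in the quotient. If the runs of `π a` and `π b` were consecutive, the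
positions from `π a` to `π b` would lie in these two runs. Either `π a + 1` is still in the first
run, which makes it `π b`, or `π b - 1` is in the second, which makes it `π a`. Both contradict the
break. -/
theorem isBreak_apply_of_isBreak (hinv : ∀ i, π (π i) = i) {a b : Fin n}
    (hab : b.val = a.val + 1) (h : IsBreak π a)
    (hr : runIndex π (π b) = runIndex π (π a) + 1) : False := by
  have hlt : (π a).val < (π b).val := by
    by_contra! hle
    have := runIndex_mono (π := π) hle
    omega
  have hne := h.ne hab
  set p : Fin n := ⟨(π a).val + 1, by omega⟩ with hp
  set q : Fin n := ⟨(π b).val - 1, by omega⟩ with hq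
  have hp1 : runIndex π (π a) ≤ runIndex π p := runIndex_mono (by simp [hp])
  have hp2 : runIndex π p ≤ runIndex π q := runIndex_mono (by simp [hp, hq]; omega)
  have hp3 : runIndex π q ≤ runIndex π (π b) := runIndex_mono (by simp [hq])
  by_cases hc : runIndex π p = runIndex π (π a)
  · have := (eq_add_of_runIndex_eq hinv 1 (π a) p rfl hc.symm).1
    rw [hinv, ← hab] at this
    have := congrArg π (Fin.ext this)
    rw [hinv] at this
    rw [← this, hp] at hne
    exact hne rfl
  · have := (eq_add_of_runIndex_eq hinv 1 q (π b) (by simp [hq]; omega) (by omega)).1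
    rw [hinv, hab] at this
    have h1 : π q = a := Fin.ext (by omega)
    have := congrArg π h1
    rw [hinv] at this
    rw [this] at hp2
    omega

/-- An indecomposable involution avoiding `321` with at least two breaks, but not with breaks
everywhere, is a proper inflation of a simple involution. -/
theorem exists_isInflationOf (h321 : IsInv321 π) (hind : IsIndecomposable π) {i j l : ℕ}
    (hij : i < j) (hi : IsBreak π i) (hj : IsBreak π j) (hl : l + 1 < n) (hnl : ¬ IsBreak π l) :
    π ∈ inflatedInv321 n := by
  classical
  have hinv := h321.1
  have hjn := hj.lt
  set m := runIndex π (n - 1) + 1 with hm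
  have hlt : ∀ k : Fin n, runIndex π k < m := fun k => by
    have : runIndex π k ≤ runIndex π (n - 1) := runIndex_mono (by omega)
    omega
  have hm2 : 2 < m := by
    have h1 := runIndex_succ_of_isBreak hi
    have h2 := runIndex_succ_of_isBreak hj
    have h3 : runIndex π (i + 1) ≤ runIndex π j := runIndex_mono (by omega)
    have h4 : runIndex π (j + 1) ≤ runIndex π (n - 1) := runIndex_mono (by omega)
    omega
  have hmn : m < n := by
    have h1 : runIndex π (n - 1) ≤ n - 1 := Nat.count_le _
    have h2 : runIndex π (n - 1) ≠ n - 1 := fun h =>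
      hnl (Nat.count_iff_forall.mp h l (by omega))
    omega
  have hstep : ∀ s, s + 1 < m → ∃ a b : Fin n, b.val = a.val + 1 ∧ runIndex π a = s ∧
      runIndex π b = s + 1 := fun s hs => by
    obtain ⟨a, ha, h1, h2⟩ := exists_step_of_lt (f := runIndex π) runIndex_succ_le
      (s := s) (N := n - 1) (by rw [runIndex_zero]; omega) (by omega)
    exact ⟨⟨a, by omega⟩, ⟨a + 1, by omega⟩, rfl, h1, h2⟩
  let block : Fin n → Fin m := fun k => ⟨runIndex π k, hlt k⟩
  have hmono : Monotone block := fun a b hab => runIndex_mono hab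
  have hsurj : Function.Surjective block := fun s => by
    by_cases h0 : s.val = 0
    · exact ⟨⟨0, by omega⟩, Fin.ext ((runIndex_zero (π := π)).trans h0.symm)⟩
    · obtain ⟨a, b, -, -, hb⟩ := hstep (s.val - 1) (by omega)
      exact ⟨b, Fin.ext (hb.trans (by omega))⟩
  have hblock : ∀ {a b}, block a = block b → block (π a) = block (π b) := fun h =>
    Fin.ext (runIndex_apply_eq hinv (congrArg Fin.val h))
  -- The quotient sends a run to the run of the image of a representative; by `hblock` the choice
  -- `r` of representatives does not matter.
  obtain ⟨r, hr⟩ := hsurj.hasRightInverse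
  have hσ : ∀ k, block (π (r (block k))) = block (π k) := fun k => hblock (hr _)
  have hσinv : Function.Involutive fun s => block (π (r s)) := fun s => by
    simp only [hσ, hinv, hr s]
  let σ : Equiv.Perm (Fin m) := hσinv.toPerm
  have hσ' : ∀ k, σ (block k) = block (π k) := hσ
  have hltb : ∀ {a b : Fin n}, block a < block b → a < b := fun h => by
    by_contra! hle
    exact absurd (hmono hle) (not_le.mpr h)
  have hinfl : ∀ a b, block a ≠ block b → (π a < π b ↔ σ (block a) < σ (block b)) := by
    intro a b hab
    rw [hσ', hσ']
    refine ⟨fun h => lt_of_le_of_ne (hmono h.le) fun h' => hab ?_, hltb⟩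
    have := hblock h'
    rwa [hinv, hinv] at this
  have hσ321 : IsInv321 σ := by
    refine ⟨hσinv, ?_⟩
    rintro ⟨a, b, c, hab, hbc, hcb, hba⟩
    obtain ⟨a, rfl⟩ := hsurj a
    obtain ⟨b, rfl⟩ := hsurj b
    obtain ⟨c, rfl⟩ := hsurj c
    exact h321.2 ⟨a, b, c, hltb hab, hltb hbc, (hinfl _ _ hbc.ne').mpr hcb,
      (hinfl _ _ hab.ne').mpr hba⟩
  have hσind : IsIndecomposable σ := by
    intro s hs hsm
    obtain ⟨a, b, hab, ha, hb⟩ := hstep (s - 1) (by omega)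
    obtain ⟨x, y, hx, hy, hxy⟩ := hind b.val (by omega) b.isLt
    have h1 : runIndex π x ≤ runIndex π a := runIndex_mono (by omega)
    have h2 : runIndex π b ≤ runIndex π y := runIndex_mono hy
    refine ⟨block x, block y, by simp only [block]; omega, by simp only [block]; omega, ?_⟩
    refine (hinfl y x fun h => ?_).mp hxy
    have : runIndex π y = runIndex π x := congrArg Fin.val h
    omega
  have hσb : ∀ s, s + 1 < m → IsBreak σ s := by
    intro s hs
    obtain ⟨a, b, hab, ha, hb⟩ := hstep s hs
    refine ⟨block a, block b, ha, hb, fun h => ?_⟩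
    rw [hσ', hσ'] at h
    refine isBreak_apply_of_isBreak hinv hab ?_ h
    by_contra hna
    have := runIndex_succ_of_not_isBreak hna
    rw [← hab] at this
    omega
  exact ⟨h321, m, hm2, hmn, σ, isSimplePerm_of hσ321 hσind hσb, hσinv, block, hmono, hsurj, hinfl⟩

end Quotient

theorem mem_simple_union_inflated_iff {n : ℕ} {π : Equiv.Perm (Fin n)} :
    π ∈ simpleInv321 n ∪ inflatedInv321 n ↔ 2 < n ∧ IsInv321 π ∧ IsIndecomposable π ∧
      ∃ i j, i < j ∧ IsBreak π i ∧ IsBreak π j := by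
  constructor
  · rintro (h | ⟨h321, m, hm, hmn, σ, hσ, -, hinf⟩)
    · obtain ⟨hn, h321, hind, hb⟩ := mem_simpleInv321_iff.mp h
      exact ⟨hn, h321, hind, 0, 1, one_pos, hb 0 (by omega), hb 1 (by omega)⟩
    · exact ⟨hm.trans hmn, h321, hinf.isIndecomposable (by omega) (hσ.isIndecomposable hm),
        hinf.exists_isBreak hm hσ⟩
  · rintro ⟨hn, h321, hind, i, j, hij, hi, hj⟩
    by_cases hall : ∀ l, l + 1 < n → IsBreak π l
    · exact Or.inl (mem_simpleInv321_iff.mpr ⟨hn, h321, hind, hall⟩)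
    · push Not at hall
      obtain ⟨l, hl, hnl⟩ := hall
      exact Or.inr (exists_isInflationOf h321 hind hij hi hj hl hnl)

/-! ### Words with levels -/

/-- The number of indices below `k` at which `b` is true. -/
def trueCount {n : ℕ} (b : Fin n → Bool) (k : ℕ) : ℕ :=
  Nat.count (fun i => ∃ h : i < n, b ⟨i, h⟩ = true) k

theorem trueCount_zero {n : ℕ} (b : Fin n → Bool) : trueCount b 0 = 0 := by simp [trueCount]

theorem trueCount_succ {n : ℕ} (b : Fin n → Bool) {k : ℕ} (hk : k < n) :
    trueCount b (k + 1) = trueCount b k + (b ⟨k, hk⟩).toNat := by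
  cases h : b ⟨k, hk⟩ <;> simp [trueCount, Nat.count_succ, hk, h]

theorem trueCount_mono {n : ℕ} (b : Fin n → Bool) : Monotone (trueCount b) :=
  Nat.count_monotone _

theorem trueCount_succ_le {n : ℕ} (b : Fin n → Bool) (k : ℕ) :
    trueCount b (k + 1) ≤ trueCount b k + 1 := by
  rw [trueCount, Nat.count_succ]
  split_ifs <;> simp [trueCount]

theorem trueCount_eq_of_agree {n m : ℕ} {b : Fin n → Bool} {c : Fin m → Bool} {k : ℕ} (hn : k ≤ n)
    (hm : k ≤ m) (h : ∀ i (h1 : i < n) (h2 : i < m), b ⟨i, h1⟩ = c ⟨i, h2⟩) :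
    trueCount b k = trueCount c k := by
  induction k with
  | zero => rw [trueCount_zero, trueCount_zero]
  | succ k ih =>
    rw [trueCount_succ b (by omega), trueCount_succ c (by omega), ih (by omega) (by omega),
      h k (by omega) (by omega)]

/-- Words in the letters `(true, false)` (up), `(false, true)` (down), `(true, true)` and
`(false, false)`, the latter only if `e ≠ 0`, that stay at levels `≥ 0`, end at level `h` and do
not have the letter `(true, true)` at level `0`. -/
def levelWords (e n h : ℕ) : Set (Fin n → Bool × Bool) :=
  {w | (∀ k < n, trueCount (fun i => (w i).2) (k + 1) ≤ trueCount (fun i => (w i).1) k) ∧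
    trueCount (fun i => (w i).1) n = trueCount (fun i => (w i).2) n + h ∧
    (e = 0 → ∀ i, w i ≠ (false, false))}

/-- The inequality at the last letter compares the second count after it with the first count before
it. So a down or `(true, true)` letter needs level at least 1, which is the path condition. -/
theorem snoc_mem_levelWords {e n h : ℕ} {w : Fin n → Bool × Bool} {l : Bool × Bool} :
    (Fin.snoc w l : Fin (n + 1) → Bool × Bool) ∈ levelWords e (n + 1) h ↔
      ∃ h', w ∈ levelWords e n h' ∧ h' + l.1.toNat = h + l.2.toNat ∧ l.2.toNat ≤ h' ∧
        (e = 0 → l ≠ (false, false)) := by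
  have hs : ∀ (f : Bool × Bool → Bool) k, k ≤ n →
      trueCount (fun i => f ((Fin.snoc w l : Fin (n + 1) → Bool × Bool) i)) k =
        trueCount (fun i => f (w i)) k := fun f k hk =>
    trueCount_eq_of_agree (by omega) hk fun i h1 h2 => by
      rw [show (⟨i, h1⟩ : Fin (n + 1)) = Fin.castSucc ⟨i, h2⟩ from rfl,
        Fin.snoc_castSucc (α := fun _ => Bool × Bool)]
  have hl : ∀ (f : Bool × Bool → Bool),
      trueCount (fun i => f ((Fin.snoc w l : Fin (n + 1) → Bool × Bool) i)) (n + 1) =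
        trueCount (fun i => f (w i)) n + (f l).toNat := fun f => by
    rw [trueCount_succ _ (by omega), hs f n le_rfl,
      show (⟨n, by omega⟩ : Fin (n + 1)) = Fin.last n from rfl, Fin.snoc_last]
  have hne : (∀ i, (Fin.snoc w l : Fin (n + 1) → Bool × Bool) i ≠ (false, false)) ↔
      (∀ i, w i ≠ (false, false)) ∧ l ≠ (false, false) := by
    rw [Fin.forall_fin_succ']
    simp only [Fin.snoc_castSucc (α := fun _ => Bool × Bool), Fin.snoc_last]
  simp only [levelWords, Set.mem_ofPred_eq, hl (fun l => l.1), hl (fun l => l.2), hne]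
  have hall : (∀ k < n + 1,
        trueCount (fun i => ((Fin.snoc w l : Fin (n + 1) → Bool × Bool) i).2) (k + 1) ≤
        trueCount (fun i => ((Fin.snoc w l : Fin (n + 1) → Bool × Bool) i).1) k) ↔
      (∀ k < n, trueCount (fun i => (w i).2) (k + 1) ≤ trueCount (fun i => (w i).1) k) ∧
        trueCount (fun i => (w i).2) n + l.2.toNat ≤ trueCount (fun i => (w i).1) n := by
    constructor
    · intro h
      refine ⟨fun k hk => ?_, ?_⟩
      · have := h k (by omega)
        rwa [hs (fun l => l.2) _ (by omega), hs (fun l => l.1) _ (by omega)] at this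
      · have := h n (by omega)
        rwa [hl (fun l => l.2), hs (fun l => l.1) _ le_rfl] at this
    · rintro ⟨h1, h2⟩ k hk
      rcases Nat.lt_succ_iff_lt_or_eq.mp hk with hk | rfl
      · rw [hs (fun l => l.2) _ (by omega), hs (fun l => l.1) _ (by omega)]
        exact h1 k hk
      · rwa [hl (fun l => l.2), hs (fun l => l.1) _ le_rfl]
  rw [hall]
  constructor
  · rintro ⟨⟨h1, h2⟩, h3, h4⟩
    exact ⟨trueCount (fun i => (w i).1) n - trueCount (fun i => (w i).2) n,
      ⟨h1, by omega, fun he => (h4 he).1⟩, by omega, by omega, fun he => (h4 he).2⟩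
  · rintro ⟨h', ⟨h1, h2, h3⟩, h4, h5, h6⟩
    exact ⟨⟨h1, by omega⟩, by omega, fun he => ⟨h3 he, h6 he⟩⟩

theorem ncard_eq_sum_ncard_snoc {α : Type*} [Fintype α] {n : ℕ} (S : Set (Fin (n + 1) → α)) :
    S.ncard = ∑ l : α, {w : Fin n → α | (Fin.snoc w l : Fin (n + 1) → α) ∈ S}.ncard := by
  classical
  simp only [Set.ncard_eq_toFinset_card']
  simp only [Set.toFinset_card, Fintype.card_subtype, Finset.card_filter, Set.coe_ofPred]
  rw [← Fintype.sum_prod_type' (f := fun (l : α) (w : Fin n → α) =>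
    if (Fin.snoc w l : Fin (n + 1) → α) ∈ S then 1 else 0)]
  exact (Fintype.sum_equiv (Fin.snocEquiv fun _ => α) _ _ fun _ => rfl).symm

theorem levelWords_snoc_eq {e n h h' : ℕ} {l : Bool × Bool}
    (h1 : h' + l.1.toNat = h + l.2.toNat) (h2 : l.2.toNat ≤ h')
    (h3 : e = 0 → l ≠ (false, false)) :
    {w : Fin n → Bool × Bool | (Fin.snoc w l : Fin (n + 1) → Bool × Bool) ∈
      levelWords e (n + 1) h} = levelWords e n h' := by
  ext w
  rw [Set.mem_ofPred_eq, snoc_mem_levelWords]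
  constructor
  · rintro ⟨k, hk, h4, -⟩
    obtain rfl : k = h' := by omega
    exact hk
  · intro hw
    exact ⟨h', hw, h1, h2, h3⟩

theorem levelWords_snoc_eq_empty {e n h : ℕ} {l : Bool × Bool}
    (hl : ∀ h', h' + l.1.toNat = h + l.2.toNat → l.2.toNat ≤ h' → e = 0 ∧ l = (false, false)) :
    {w : Fin n → Bool × Bool | (Fin.snoc w l : Fin (n + 1) → Bool × Bool) ∈
      levelWords e (n + 1) h} = ∅ := by
  ext w
  rw [Set.mem_ofPred_eq, snoc_mem_levelWords]
  simp only [Set.mem_empty_iff_false, iff_false]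
  rintro ⟨h', -, h1, h2, h3⟩
  exact h3 (hl h' h1 h2).1 (hl h' h1 h2).2

theorem ncard_levelWords {e : ℕ} (he : e ≤ 1) (n : ℕ) :
    ∀ h, (levelWords e n h).ncard = pathCount e n h := by
  induction n with
  | zero =>
    intro h
    cases h with
    | zero =>
      have : levelWords e 0 0 = {Fin.elim0} := by
        ext w
        simp [levelWords, trueCount_zero, Subsingleton.elim w Fin.elim0]
      rw [this]
      simp [pathCount]
    | succ h =>
      have : levelWords e 0 (h + 1) = ∅ := by
        ext w
        simp [levelWords, trueCount_zero]
      rw [this]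
      simp [pathCount]
  | succ n ih =>
    intro h
    have hff : {w : Fin n → Bool × Bool | (Fin.snoc w (false, false) : Fin (n + 1) → Bool × Bool) ∈
      levelWords e (n + 1) h}.ncard = e * pathCount e n h := by
      rcases Nat.le_one_iff_eq_zero_or_eq_one.mp he with rfl | rfl
      · rw [levelWords_snoc_eq_empty (by simp)]
        simp
      · rw [levelWords_snoc_eq (h' := h) (by simp) (by simp) (by simp), ih, one_mul]
    rw [ncard_eq_sum_ncard_snoc, Fintype.sum_prod_type]
    simp only [Fintype.sum_bool]
    rw [hff, levelWords_snoc_eq (h' := h + 1) (l := (false, true)) (by simp) (by simp) (by simp),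
      ih]
    cases h with
    | zero =>
      rw [levelWords_snoc_eq_empty (l := (true, true)) (by simp),
        levelWords_snoc_eq_empty (l := (true, false)) (by simp)]
      simp [pathCount]
    | succ h =>
      rw [levelWords_snoc_eq (h' := h + 1) (l := (true, true)) (by simp) (by simp) (by simp),
        levelWords_snoc_eq (h' := h) (l := (true, false)) (by simp) (by simp) (by simp), ih, ih]
      rw [pathCount, show h + 1 + 1 = h + 2 from rfl]
      omega

/-! ### Arc systems -/

/-- The positions below `2 * n + 2` are split into openers `u 0 < ⋯ < u n` and closers
`d 0 < ⋯ < d n` with `u k < d k`. -/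
structure IsArcSystem (n : ℕ) (u d : ℕ → ℕ) : Prop where
  u_lt : ∀ j k, j < k → k ≤ n → u j < u k
  d_lt : ∀ j k, j < k → k ≤ n → d j < d k
  lt : ∀ k ≤ n, u k < d k
  ne : ∀ j ≤ n, ∀ k ≤ n, u j ≠ d k
  bound : ∀ k ≤ n, d k < 2 * n + 2
  cover : ∀ p < 2 * n + 2, (∃ k ≤ n, u k = p) ∨ ∃ k ≤ n, d k = p

namespace IsArcSystem

variable {n : ℕ} {u d : ℕ → ℕ}

theorem u_lt_iff (h : IsArcSystem n u d) {j k : ℕ} (hj : j ≤ n) (hk : k ≤ n) :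
    u j < u k ↔ j < k := by
  refine ⟨fun hlt => ?_, fun hlt => h.u_lt j k hlt hk⟩
  by_contra! hle
  rcases hle.eq_or_lt with rfl | hlt'
  · omega
  · have := h.u_lt k j hlt' hj
    omega

theorem d_lt_iff (h : IsArcSystem n u d) {j k : ℕ} (hj : j ≤ n) (hk : k ≤ n) :
    d j < d k ↔ j < k := by
  refine ⟨fun hlt => ?_, fun hlt => h.d_lt j k hlt hk⟩
  by_contra! hle
  rcases hle.eq_or_lt with rfl | hlt'
  · omega
  · have := h.d_lt k j hlt' hj
    omega

theorem u_inj (h : IsArcSystem n u d) {j k : ℕ} (hj : j ≤ n) (hk : k ≤ n) (e : u j = u k) :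
    j = k := by
  have h1 := h.u_lt_iff hj hk
  have h2 := h.u_lt_iff hk hj
  omega

theorem d_inj (h : IsArcSystem n u d) {j k : ℕ} (hj : j ≤ n) (hk : k ≤ n) (e : d j = d k) :
    j = k := by
  have h1 := h.d_lt_iff hj hk
  have h2 := h.d_lt_iff hk hj
  omega

theorem u_bound (h : IsArcSystem n u d) {k : ℕ} (hk : k ≤ n) : u k < 2 * n + 2 :=
  (h.lt k hk).trans (h.bound k hk)

theorem d_last (h : IsArcSystem n u d) : d n = 2 * n + 1 := by
  have hb := h.bound n le_rfl
  rcases h.cover (2 * n + 1) (by omega) with ⟨k, hk, e⟩ | ⟨k, hk, e⟩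
  · have h1 := h.lt k hk
    have h2 := h.bound k hk
    omega
  · have := h.d_lt_iff le_rfl hk
    omega

end IsArcSystem

/-- The rank of a member of one of two increasing sequences that together list all numbers below
it. -/
theorem eq_index_add_card {n : ℕ} {f g : ℕ → ℕ} (hf : ∀ j k, j < k → k ≤ n → f j < f k)
    (hg : ∀ j k, j < k → k ≤ n → g j < g k) (hne : ∀ j ≤ n, ∀ k ≤ n, f j ≠ g k) {j : ℕ}
    (hj : j ≤ n) (hcov : ∀ p < f j, (∃ k ≤ n, f k = p) ∨ ∃ k ≤ n, g k = p) :
    f j = j + ((Finset.range (n + 1)).filter fun k => g k < f j).card := by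
  have hinj : ∀ {f : ℕ → ℕ}, (∀ j k, j < k → k ≤ n → f j < f k) → ∀ j ≤ n, ∀ k ≤ n,
      f j = f k → j = k := fun hf j hj k hk e => by
    rcases lt_trichotomy j k with h | h | h
    · have := hf j k h hk; omega
    · exact h
    · have := hf k j h hj; omega
  have heq : Finset.range (f j) = (Finset.range j).image f ∪
      ((Finset.range (n + 1)).filter fun k => g k < f j).image g := by
    ext p
    simp only [Finset.mem_range, Finset.mem_union, Finset.mem_image, Finset.mem_filter]
    constructor
    · intro hp
      rcases hcov p hp with ⟨k, hk, rfl⟩ | ⟨k, hk, rfl⟩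
      · left
        refine ⟨k, ?_, rfl⟩
        by_contra! hle
        rcases hle.eq_or_lt with rfl | hlt
        · omega
        · have := hf j k hlt hk; omega
      · exact Or.inr ⟨k, ⟨by omega, hp⟩, rfl⟩
    · rintro (⟨k, hk, rfl⟩ | ⟨k, ⟨hk, hlt⟩, rfl⟩)
      · exact hf k j hk hj
      · exact hlt
  have hcard := congrArg Finset.card heq
  rw [Finset.card_range, Finset.card_union_of_disjoint, Finset.card_image_of_injOn,
    Finset.card_image_of_injOn, Finset.card_range] at hcard
  · exact hcard
  · intro a ha b hb e
    simp only [Finset.coe_filter, Finset.mem_range, Set.mem_ofPred_eq] at ha hb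
    exact hinj hg a (by omega) b (by omega) e
  · intro a ha b hb e
    simp only [Finset.coe_range, Set.mem_Iio] at ha hb
    exact hinj hf a (by omega) b (by omega) e
  · rw [Finset.disjoint_left]
    simp only [Finset.mem_image, Finset.mem_range, Finset.mem_filter]
    rintro _ ⟨a, ha, rfl⟩ ⟨b, ⟨hb, -⟩, e⟩
    exact hne a (by omega) b (by omega) e.symm

/-! ### Gap counts determine the arc system -/

/-- `α` and `β` count the indices at which consecutive closers, respectively openers, are not
adjacent. -/
structure IsGapCount (n : ℕ) (u d α β : ℕ → ℕ) : Prop where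
  α_zero : α 0 = 0
  β_zero : β 0 = 0
  α_succ : ∀ k < n, α (k + 1) = α k + if d (k + 1) = d k + 1 then 0 else 1
  β_succ : ∀ k < n, β (k + 1) = β k + if u (k + 1) = u k + 1 then 0 else 1

namespace IsGapCount

variable {n : ℕ} {u d α β : ℕ → ℕ}

theorem α_mono (h : IsGapCount n u d α β) {j k : ℕ} (hjk : j ≤ k) (hk : k ≤ n) : α j ≤ α k := by
  induction k, hjk using Nat.le_induction with
  | base => exact le_rfl
  | succ k hjk ih =>
    have := h.α_succ k (by omega)
    have := ih (by omega)
    omega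

theorem β_mono (h : IsGapCount n u d α β) {j k : ℕ} (hjk : j ≤ k) (hk : k ≤ n) : β j ≤ β k := by
  induction k, hjk using Nat.le_induction with
  | base => exact le_rfl
  | succ k hjk ih =>
    have := h.β_succ k (by omega)
    have := ih (by omega)
    omega

theorem α_succ_le (h : IsGapCount n u d α β) {k : ℕ} (hk : k < n) : α (k + 1) ≤ α k + 1 := by
  rw [h.α_succ k hk]
  split_ifs <;> omega

theorem β_succ_le (h : IsGapCount n u d α β) {k : ℕ} (hk : k < n) : β (k + 1) ≤ β k + 1 := by
  rw [h.β_succ k hk]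
  split_ifs <;> omega

/-- If an opener follows immediately on the closer `d k`, then `α` increases after `k`. -/
theorem α_lt_of_between (h : IsGapCount n u d α β) (ha : IsArcSystem n u d) {i k l : ℕ}
    (hi : i ≤ n) (hl : l ≤ n) (hk : k ≤ n) (h1 : u i = d k + 1) (h2 : u i < d l) : α k < α l := by
  have hkl : k < l := (ha.d_lt_iff hk hl).mp (by omega)
  have hne := ha.ne i hi (k + 1) (by omega)
  have hs := h.α_succ k (by omega)
  rw [if_neg (by omega)] at hs
  have := h.α_mono (j := k + 1) (k := l) hkl hl
  omega

/-- If a closer follows immediately on the opener `u k`, then `β` increases after `k`. -/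
theorem β_lt_of_between (h : IsGapCount n u d α β) (ha : IsArcSystem n u d) {i k l : ℕ}
    (hi : i ≤ n) (hl : l ≤ n) (hk : k ≤ n) (h1 : d i = u k + 1) (h2 : d i < u l) : β k < β l := by
  have hkl : k < l := (ha.u_lt_iff hk hl).mp (by omega)
  have hne := ha.ne (k + 1) (by omega) i hi
  have hs := h.β_succ k (by omega)
  rw [if_neg (by omega)] at hs
  have := h.β_mono (j := k + 1) (k := l) hkl hl
  omega

/-- Look at the position just before `u (j + 1)`. If it is an opener, it is `u j` and `β` does not
change. If it is a closer `d i`, then `i < k` and `β j ≤ α i` by induction, while the opener after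
`d i` forces `α i < α k`, which makes up for the growth of `β`. -/
theorem le_of_lt (h : IsGapCount n u d α β) (ha : IsArcSystem n u d) (k : ℕ) :
    k ≤ n → ∀ j ≤ n, u j < d k → β j ≤ α k := by
  induction k using Nat.strong_induction_on with
  | _ k ihk =>
    intro hk j
    induction j with
    | zero => intro _ _; rw [h.β_zero]; omega
    | succ j ihj =>
      intro hj hlt
      have hu := ha.u_lt j (j + 1) (by omega) hj
      have hub := ha.u_bound hj
      rcases ha.cover (u (j + 1) - 1) (by omega) with ⟨i, hi, e⟩ | ⟨i, hi, e⟩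
      · have h1 := (ha.u_lt_iff hi hj).mp (by omega)
        have h2 := ha.u_lt_iff hi (show j ≤ n by omega)
        have h3 := ha.u_lt_iff (show j ≤ n by omega) hi
        obtain rfl : i = j := by omega
        rw [h.β_succ i (by omega), if_pos (by omega), add_zero]
        exact ihj (by omega) (by omega)
      · have h1 := (ha.d_lt_iff hi hk).mp (by omega)
        have h2 := ihk i h1 hi j (by omega) (by have := ha.ne j (by omega) i hi; omega)
        have h3 := h.α_lt_of_between ha hj hk hi (by omega) hlt
        have h4 := h.β_succ_le (show j < n by omega)
        omega

/-- The mirror argument at the position just before a closer. It starts strictly because the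
position before `d 0` is an opener, so `β` has already increased. -/
theorem lt_of_lt (h : IsGapCount n u d α β) (ha : IsArcSystem n u d) (j : ℕ) :
    j ≤ n → ∀ k ≤ n, d k < u j → α k < β j := by
  induction j using Nat.strong_induction_on with
  | _ j ihj =>
    intro hj k
    induction k with
    | zero =>
      intro hk hlt
      have h0 := ha.lt 0 hk
      have hb := ha.bound 0 hk
      rcases ha.cover (d 0 - 1) (by omega) with ⟨i, hi, e⟩ | ⟨i, hi, e⟩
      · have := h.β_lt_of_between ha hk hj hi (by omega) hlt
        rw [h.α_zero]
        omega
      · have := ha.d_lt_iff hi hk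
        omega
    | succ k ihk =>
      intro hk hlt
      have hd := ha.d_lt k (k + 1) (by omega) hk
      have hdb := ha.bound _ hk
      rcases ha.cover (d (k + 1) - 1) (by omega) with ⟨i, hi, e⟩ | ⟨i, hi, e⟩
      · have h1 := (ha.u_lt_iff hi hj).mp (by omega)
        have h2 := ihj i h1 hi k (by omega) (by have := ha.ne i hi k (by omega); omega)
        have h3 := h.β_lt_of_between ha hk hj hi (by omega) hlt
        have h4 := h.α_succ_le (show k < n by omega)
        omega
      · have h1 := (ha.d_lt_iff hi hk).mp (by omega)
        have h2 := ha.d_lt_iff hi (show k ≤ n by omega)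
        have h3 := ha.d_lt_iff (show k ≤ n by omega) hi
        obtain rfl : i = k := by omega
        rw [h.α_succ i (by omega), if_pos (by omega), add_zero]
        exact ihk (by omega) (by omega)

theorem u_lt_d_iff (h : IsGapCount n u d α β) (ha : IsArcSystem n u d) {j k : ℕ} (hj : j ≤ n)
    (hk : k ≤ n) : u j < d k ↔ β j ≤ α k := by
  refine ⟨h.le_of_lt ha k hk j hj, fun hle => ?_⟩
  by_contra hn
  have := h.lt_of_lt ha j hj k hk (by have := ha.ne j hj k hk; omega)
  omega

theorem d_lt_u_iff (h : IsGapCount n u d α β) (ha : IsArcSystem n u d) {j k : ℕ} (hj : j ≤ n)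
    (hk : k ≤ n) : d k < u j ↔ α k < β j := by
  have h1 := h.u_lt_d_iff ha hj hk
  have h2 := ha.ne j hj k hk
  omega

theorem u_eq (h : IsGapCount n u d α β) (ha : IsArcSystem n u d) {j : ℕ} (hj : j ≤ n) :
    u j = j + ((Finset.range (n + 1)).filter fun k => α k < β j).card := by
  rw [eq_index_add_card ha.u_lt ha.d_lt ha.ne hj fun p hp => ha.cover p
    (hp.trans (ha.u_bound hj))]
  congr 2
  refine Finset.filter_congr fun k hk => h.d_lt_u_iff ha hj ?_
  simpa [Nat.lt_succ_iff] using hk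

theorem d_eq (h : IsGapCount n u d α β) (ha : IsArcSystem n u d) {k : ℕ} (hk : k ≤ n) :
    d k = k + ((Finset.range (n + 1)).filter fun j => β j ≤ α k).card := by
  rw [eq_index_add_card ha.d_lt ha.u_lt (fun j hj k hk => (ha.ne k hk j hj).symm) hk
    fun p hp => (ha.cover p (hp.trans (ha.bound k hk))).symm]
  congr 2
  refine Finset.filter_congr fun j hj => h.u_lt_d_iff ha ?_ hk
  simpa [Nat.lt_succ_iff] using hj

/-- Arc systems are determined by their gap counts. -/
theorem unique {u' d' : ℕ → ℕ} (h : IsGapCount n u d α β) (ha : IsArcSystem n u d)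
    (h' : IsGapCount n u' d' α β) (ha' : IsArcSystem n u' d') {k : ℕ} (hk : k ≤ n) :
    u k = u' k ∧ d k = d' k :=
  ⟨(h.u_eq ha hk).trans (h'.u_eq ha' hk).symm, (h.d_eq ha hk).trans (h'.d_eq ha' hk).symm⟩

/-- After the last opener only closers remain, hence no gaps between them. If `α n` exceeded `β n`,
there would be a gap after a closer `d i` with `α i = β n`, which lies beyond `u n`. -/
theorem α_last_eq (h : IsGapCount n u d α β) (ha : IsArcSystem n u d) : α n = β n := by
  refine le_antisymm ?_ ((h.u_lt_d_iff ha le_rfl le_rfl).mp (ha.lt n le_rfl))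
  by_contra! hlt
  obtain ⟨i, hi, h1, h2⟩ : ∃ i < n, α i = β n ∧ α (i + 1) = β n + 1 := by
    -- Only the values of `α` up to `n` are controlled, so the sequence is frozen there.
    have := exists_step_of_lt (f := fun k => α (min k n)) (s := β n) (N := n) (fun i => ?_)
      (by simp [h.α_zero]) (by simpa using hlt)
    · obtain ⟨i, hi, h1, h2⟩ := this
      simp only [min_eq_left hi.le, min_eq_left (show i + 1 ≤ n from hi)] at h1 h2
      exact ⟨i, hi, h1, h2⟩
    · rcases lt_or_ge i n with hi | hi
      · simpa only [min_eq_left hi.le, min_eq_left (show i + 1 ≤ n from hi)] using h.α_succ_le hi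
      · simp only [min_eq_right hi, min_eq_right (show n ≤ i + 1 by omega)]
        omega
  have hs := h.α_succ i hi
  have hd := ha.d_lt i (i + 1) (by omega) hi
  have hb := ha.bound (i + 1) hi
  have hne : d (i + 1) ≠ d i + 1 := fun e => by rw [if_pos e] at hs; omega
  have hu := (h.u_lt_d_iff ha le_rfl (show i ≤ n by omega)).mpr (by omega)
  rcases ha.cover (d i + 1) (by omega) with ⟨k, hk, e⟩ | ⟨k, hk, e⟩
  · have := ha.u_lt_iff le_rfl hk
    omega
  · have h3 := ha.d_lt_iff (show i ≤ n by omega) hk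
    have h4 := ha.d_lt_iff hk (show i + 1 ≤ n from hi)
    omega

end IsGapCount

/-! ### The arc system with given gap counts -/

section Construction

variable {n : ℕ} {α β : ℕ → ℕ}

/-- The openers of the arc system with gap counts `α`, `β`. -/
def openerOf (n : ℕ) (α β : ℕ → ℕ) (j : ℕ) : ℕ :=
  j + ((Finset.range (n + 1)).filter fun k => α k < β j).card

/-- The closers of the arc system with gap counts `α`, `β`. -/
def closerOf (n : ℕ) (α β : ℕ → ℕ) (k : ℕ) : ℕ :=
  k + ((Finset.range (n + 1)).filter fun j => β j ≤ α k).card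

/-- By monotonicity at most `k` closers are counted below the opener and at least `j + 1` openers
below the closer, so the two ranks are separated by `j + k`. -/
theorem openerOf_lt_closerOf (hα : Monotone α) (hβ : Monotone β) {j k : ℕ} (hj : j ≤ n)
    (h : β j ≤ α k) : openerOf n α β j < closerOf n α β k := by
  have h1 : ((Finset.range (n + 1)).filter fun k => α k < β j).card ≤ k := by
    rw [← Finset.card_range k]
    refine Finset.card_le_card fun i hi => ?_
    simp only [Finset.mem_filter, Finset.mem_range] at hi ⊢
    by_contra! hki
    have := hα hki
    omega
  have h2 : j + 1 ≤ ((Finset.range (n + 1)).filter fun i => β i ≤ α k).card := by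
    rw [← Finset.card_range (j + 1)]
    refine Finset.card_le_card fun i hi => ?_
    simp only [Finset.mem_filter, Finset.mem_range] at hi ⊢
    exact ⟨by omega, (hβ (show i ≤ j by omega)).trans h⟩
  rw [openerOf, closerOf]
  omega

theorem closerOf_lt_openerOf (hα : Monotone α) (hβ : Monotone β) {j k : ℕ} (hk : k ≤ n)
    (h : α k < β j) : closerOf n α β k < openerOf n α β j := by
  have h1 : ((Finset.range (n + 1)).filter fun i => β i ≤ α k).card ≤ j := by
    rw [← Finset.card_range j]
    refine Finset.card_le_card fun i hi => ?_
    simp only [Finset.mem_filter, Finset.mem_range] at hi ⊢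
    by_contra! hki
    have := hβ hki
    omega
  have h2 : k + 1 ≤ ((Finset.range (n + 1)).filter fun k => α k < β j).card := by
    rw [← Finset.card_range (k + 1)]
    refine Finset.card_le_card fun i hi => ?_
    simp only [Finset.mem_filter, Finset.mem_range] at hi ⊢
    exact ⟨by omega, (hα (show i ≤ k by omega)).trans_lt h⟩
  rw [openerOf, closerOf]
  omega

theorem openerOf_mono_lt (hβ : Monotone β) {j k : ℕ} (hjk : j < k) :
    openerOf n α β j < openerOf n α β k := by
  refine add_lt_add_of_lt_of_le hjk (Finset.card_le_card fun i hi => ?_)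
  simp only [Finset.mem_filter] at hi ⊢
  exact ⟨hi.1, hi.2.trans_le (hβ hjk.le)⟩

theorem closerOf_mono_lt (hα : Monotone α) {j k : ℕ} (hjk : j < k) :
    closerOf n α β j < closerOf n α β k := by
  refine add_lt_add_of_lt_of_le hjk (Finset.card_le_card fun i hi => ?_)
  simp only [Finset.mem_filter] at hi ⊢
  exact ⟨hi.1, hi.2.trans (hα hjk.le)⟩

theorem isArcSystem_of_monotone (hα : Monotone α) (hβ : Monotone β) (h : ∀ k ≤ n, β k ≤ α k) :
    IsArcSystem n (openerOf n α β) (closerOf n α β) := by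
  have hne : ∀ j ≤ n, ∀ k ≤ n, openerOf n α β j ≠ closerOf n α β k := fun j hj k hk => by
    rcases le_or_gt (β j) (α k) with hle | hlt
    · exact (openerOf_lt_closerOf hα hβ hj hle).ne
    · exact (closerOf_lt_openerOf hα hβ hk hlt).ne'
  have hlt : ∀ k ≤ n, openerOf n α β k < closerOf n α β k := fun k hk =>
    openerOf_lt_closerOf hα hβ hk (h k hk)
  have hbound : ∀ k ≤ n, closerOf n α β k < 2 * n + 2 := fun k hk => by
    have := Finset.card_filter_le (Finset.range (n + 1)) fun j => β j ≤ α k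
    rw [Finset.card_range] at this
    rw [closerOf]
    omega
  refine ⟨fun j k hjk _ => openerOf_mono_lt hβ hjk, fun j k hjk _ => closerOf_mono_lt hα hjk,
    hlt, hne, hbound, ?_⟩
  have hu : StrictMono (openerOf n α β) := fun _ _ => openerOf_mono_lt hβ
  have hd : StrictMono (closerOf n α β) := fun _ _ => closerOf_mono_lt hα
  -- The cover follows by counting: there are `2 * n + 2` distinct values below `2 * n + 2`.
  have heq : (Finset.range (n + 1)).image (openerOf n α β) ∪
      (Finset.range (n + 1)).image (closerOf n α β) = Finset.range (2 * n + 2) := by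
    refine Finset.eq_of_subset_of_card_le ?_ ?_
    · intro p
      simp only [Finset.mem_union, Finset.mem_image, Finset.mem_range, Nat.lt_succ_iff]
      rintro (⟨k, hk, rfl⟩ | ⟨k, hk, rfl⟩)
      · exact Nat.lt_succ_iff.mp ((hlt k hk).trans (hbound k hk))
      · exact Nat.lt_succ_iff.mp (hbound k hk)
    · rw [Finset.card_union_of_disjoint, Finset.card_image_of_injective _ hu.injective,
        Finset.card_image_of_injective _ hd.injective, Finset.card_range, Finset.card_range]
      · omega
      · rw [Finset.disjoint_left]
        simp only [Finset.mem_image, Finset.mem_range]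
        rintro _ ⟨a, ha, rfl⟩ ⟨b, hb, e⟩
        exact hne a (by omega) b (by omega) e.symm
  intro p hp
  have hp' := heq.symm ▸ Finset.mem_range.mpr hp
  simpa only [Finset.mem_union, Finset.mem_image, Finset.mem_range, Nat.lt_succ_iff] using hp'

/-- Where a count is constant, the rank formula gives adjacent positions. Where `α` rises, `β`
passes through the same step somewhere because both end at the same value, and the opener after that
step separates the two closers. For `β`, a closer with `α i = β k` separates the two openers. -/
theorem isGapCount_of (hα : Monotone α) (hβ : Monotone β) (hα0 : α 0 = 0) (hβ0 : β 0 = 0)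
    (hα1 : ∀ k, α (k + 1) ≤ α k + 1) (hβ1 : ∀ k, β (k + 1) ≤ β k + 1) (hlast : α n = β n) :
    IsGapCount n (openerOf n α β) (closerOf n α β) α β := by
  refine ⟨hα0, hβ0, fun k hk => ?_, fun k hk => ?_⟩
  · have hm := hα (Nat.le_succ k)
    have h1 := hα1 k
    split_ifs with h
    · by_contra hne
      obtain ⟨i, hi, h2, h3⟩ := exists_step_of_lt hβ1 (s := α k) (N := n) (by omega) (by
        have := hα (show k + 1 ≤ n from hk)
        simp only [Nat.succ_eq_add_one] at *
        omega)
      have h4 := closerOf_lt_openerOf (j := i + 1) hα hβ (show k ≤ n by omega) (by omega)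
      have h5 := openerOf_lt_closerOf (k := k + 1) hα hβ (show i + 1 ≤ n from hi) (by
        simp only [Nat.succ_eq_add_one] at *
        omega)
      omega
    · by_contra hne
      have he : α (k + 1) = α k := by simp only [Nat.succ_eq_add_one] at *; omega
      apply h
      rw [closerOf, closerOf, he]
      omega
  · have hm := hβ (Nat.le_succ k)
    have h1 := hβ1 k
    split_ifs with h
    · by_contra hne
      have h3 := hβ (show k + 1 ≤ n from hk)
      obtain ⟨i, hi, h2⟩ : ∃ i ≤ n, α i = β k := by
        obtain ⟨i, hi, h2, -⟩ := exists_step_of_lt hα1 (s := β k) (N := n) (by omega) (by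
          simp only [Nat.succ_eq_add_one] at *
          omega)
        exact ⟨i, hi.le, h2⟩
      have h4 := openerOf_lt_closerOf (k := i) hα hβ (show k ≤ n by omega) (by omega)
      have h5 := closerOf_lt_openerOf (j := k + 1) hα hβ hi (by
        simp only [Nat.succ_eq_add_one] at *
        omega)
      omega
    · by_contra hne
      have he : β (k + 1) = β k := by simp only [Nat.succ_eq_add_one] at *; omega
      apply h
      rw [openerOf, openerOf, he]
      omega

end Construction

/-! ### Involutions and their arcs -/

/-- The involution `π` exchanges the openers and closers of an arc system. -/
structure IsArcsOf {n : ℕ} (π : Equiv.Perm (Fin (2 * n + 2))) (u d : ℕ → ℕ) : Prop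
    extends IsArcSystem n u d where
  apply_u : ∀ k ≤ n, ∀ i : Fin (2 * n + 2), i.val = u k → (π i).val = d k
  apply_d : ∀ k ≤ n, ∀ i : Fin (2 * n + 2), i.val = d k → (π i).val = u k

theorem IsArcSystem.exists_perm {n : ℕ} {u d : ℕ → ℕ} (h : IsArcSystem n u d) :
    ∃ π : Equiv.Perm (Fin (2 * n + 2)), IsArcsOf π u d := by
  have hex : ∀ p : Fin (2 * n + 2), ∃ q : Fin (2 * n + 2), ∃ k ≤ n,
      (p.val = u k ∧ q.val = d k) ∨ (p.val = d k ∧ q.val = u k) := fun p => by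
    rcases h.cover p p.isLt with ⟨k, hk, e⟩ | ⟨k, hk, e⟩
    · exact ⟨⟨d k, h.bound k hk⟩, k, hk, Or.inl ⟨e.symm, rfl⟩⟩
    · exact ⟨⟨u k, h.u_bound hk⟩, k, hk, Or.inr ⟨e.symm, rfl⟩⟩
  choose f hf using hex
  have hu : ∀ k ≤ n, ∀ i : Fin (2 * n + 2), i.val = u k → (f i).val = d k := fun k hk i hi => by
    obtain ⟨l, hl, ⟨h1, h2⟩ | ⟨h1, h2⟩⟩ := hf i
    · rw [h2, h.u_inj hl hk (by omega)]
    · exact absurd (hi.symm.trans h1) (h.ne k hk l hl)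
  have hd : ∀ k ≤ n, ∀ i : Fin (2 * n + 2), i.val = d k → (f i).val = u k := fun k hk i hi => by
    obtain ⟨l, hl, ⟨h1, h2⟩ | ⟨h1, h2⟩⟩ := hf i
    · exact absurd (h1.symm.trans hi) (h.ne l hl k hk)
    · rw [h2, h.d_inj hl hk (by omega)]
  have hinv : Function.Involutive f := fun p => by
    apply Fin.ext
    obtain ⟨k, hk, ⟨h1, h2⟩ | ⟨h1, h2⟩⟩ := hf p
    · rw [hd k hk _ h2, h1]
    · rw [hu k hk _ h2, h1]
  exact ⟨hinv.toPerm, h, hu, hd⟩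

namespace IsArcsOf

variable {n : ℕ} {π π' : Equiv.Perm (Fin (2 * n + 2))} {u d u' d' : ℕ → ℕ}

theorem perm_unique (h : IsArcsOf π u d) (h' : IsArcsOf π' u' d')
    (e : ∀ k ≤ n, u k = u' k ∧ d k = d' k) : π = π' := by
  ext i
  rcases h.cover i i.isLt with ⟨k, hk, hi⟩ | ⟨k, hk, hi⟩
  · rw [h.apply_u k hk i hi.symm, h'.apply_u k hk i (by rw [← hi, (e k hk).1]), (e k hk).2]
  · rw [h.apply_d k hk i hi.symm, h'.apply_d k hk i (by rw [← hi, (e k hk).2]), (e k hk).1]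

theorem exists_eq_u_of_lt (h : IsArcsOf π u d) {i : Fin (2 * n + 2)} (hi : i < π i) :
    ∃ k ≤ n, u k = i := by
  rcases h.cover i i.isLt with hk | ⟨k, hk, e⟩
  · exact hk
  · have h1 := h.apply_d k hk i e.symm
    have h2 := h.lt k hk
    rw [Fin.lt_def] at hi
    omega

theorem exists_eq_u (h : IsArcsOf π u d) (h' : IsArcsOf π u' d') {k : ℕ} (hk : k ≤ n) :
    ∃ l ≤ n, u' l = u k := by
  refine h'.exists_eq_u_of_lt (i := ⟨u k, h.u_bound hk⟩) ?_
  rw [Fin.lt_def, h.apply_u k hk _ rfl]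
  exact h.lt k hk

/-- The openers are the positions `i < π i`, and they have only one increasing enumeration. -/
theorem arcs_unique (h : IsArcsOf π u d) (h' : IsArcsOf π u' d') {k : ℕ} (hk : k ≤ n) :
    u k = u' k ∧ d k = d' k := by
  have hu : ∀ k, k ≤ n → u k = u' k := fun k => by
    induction k using Nat.strong_induction_on with
    | _ k ih =>
      intro hk
      obtain ⟨l, hl, e⟩ := h.exists_eq_u h' hk
      obtain ⟨m, hm, e'⟩ := h'.exists_eq_u h hk
      rcases lt_trichotomy l k with hlk | rfl | hlk
      · have h1 := ih l hlk hl
        have h2 := h.u_lt l k hlk hk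
        omega
      · exact e.symm
      · have h1 := h'.u_lt k l hlk hl
        have h2 := (h.u_lt_iff hm hk).mp (by omega)
        have h3 := ih m h2 hm
        have h4 := h'.u_lt m k h2 hk
        omega
  refine ⟨hu k hk, ?_⟩
  rw [← h.apply_u k hk ⟨u k, h.u_bound hk⟩ rfl, h'.apply_u k hk _ (hu k hk)]

/-- `π` increases on openers and on closers, and two of any three positions are of the same kind. -/
theorem isInv321 (h : IsArcsOf π u d) : IsInv321 π := by
  refine ⟨fun i => ?_, ?_⟩
  · apply Fin.ext
    rcases h.cover i i.isLt with ⟨k, hk, hi⟩ | ⟨k, hk, hi⟩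
    · rw [h.apply_d k hk _ (h.apply_u k hk i hi.symm), hi]
    · rw [h.apply_u k hk _ (h.apply_d k hk i hi.symm), hi]
  · have hu : ∀ i j : Fin (2 * n + 2), i < j → π j < π i → (∃ k ≤ n, u k = i) →
        (∃ k ≤ n, u k = j) → False := by
      rintro i j hij hπ ⟨k, hk, hi⟩ ⟨l, hl, hj⟩
      rw [Fin.lt_def] at hij hπ
      rw [h.apply_u k hk i hi.symm, h.apply_u l hl j hj.symm, h.d_lt_iff hl hk] at hπ
      rw [← hi, ← hj, h.u_lt_iff hk hl] at hij
      omega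
    have hd : ∀ i j : Fin (2 * n + 2), i < j → π j < π i → (∃ k ≤ n, d k = i) →
        (∃ k ≤ n, d k = j) → False := by
      rintro i j hij hπ ⟨k, hk, hi⟩ ⟨l, hl, hj⟩
      rw [Fin.lt_def] at hij hπ
      rw [h.apply_d k hk i hi.symm, h.apply_d l hl j hj.symm, h.u_lt_iff hl hk] at hπ
      rw [← hi, ← hj, h.d_lt_iff hk hl] at hij
      omega
    rintro ⟨i, j, k, hij, hjk, hkj, hji⟩
    rcases h.cover i i.isLt with hi | hi <;> rcases h.cover j j.isLt with hj | hj <;>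
      rcases h.cover k k.isLt with hk | hk
    · exact hu i j hij hji hi hj
    · exact hu i j hij hji hi hj
    · exact hu i k (hij.trans hjk) (hkj.trans hji) hi hk
    · exact hd j k hjk hkj hj hk
    · exact hu j k hjk hkj hj hk
    · exact hd i k (hij.trans hjk) (hkj.trans hji) hi hk
    · exact hd i j hij hji hi hj
    · exact hd i j hij hji hi hj

/-- If `d k < u (k + 1)`, then `π` splits at `u (k + 1)`. Otherwise consecutive arcs overlap and
reach from the first position to the last, so every cut crosses an arc, which is an inversion. -/
theorem isIndecomposable_iff (h : IsArcsOf π u d) :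
    IsIndecomposable π ↔ ∀ k < n, u (k + 1) < d k := by
  constructor
  · intro hind k hk
    have hk' : k + 1 ≤ n := hk
    by_contra hlt
    have hlt' : d k < u (k + 1) := by
      have := h.ne (k + 1) hk k hk.le
      omega
    have hb := h.u_bound hk'
    obtain ⟨a, b, ha, hb, hab⟩ := hind (u (k + 1)) (by omega) hb
    have ha' : (π a).val < u (k + 1) := by
      rcases h.cover a a.isLt with ⟨l, hl, e⟩ | ⟨l, hl, e⟩
      · rw [h.apply_u l hl a e.symm]
        have h1 := (h.u_lt_iff hl hk').mp (by omega)
        have h2 := h.d_lt_iff hk.le hl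
        omega
      · rw [h.apply_d l hl a e.symm]
        have := h.lt l hl
        omega
    rw [Fin.lt_def] at hab
    rcases h.cover b b.isLt with ⟨l, hl, e⟩ | ⟨l, hl, e⟩
    · have h1 := h.apply_u l hl b e.symm
      have := h.lt l hl
      omega
    · have h1 := h.apply_d l hl b e.symm
      have h2 := (h.u_lt_iff hl hk').mp (by omega)
      have h3 := h.d_lt_iff hk.le hl
      omega
  · intro hk s hs hsn
    have h0 : u 0 = 0 := by
      rcases h.cover 0 (by omega) with ⟨l, hl, e⟩ | ⟨l, hl, e⟩
      · have := h.u_lt_iff hl (Nat.zero_le n)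
        omega
      · have := h.lt l hl
        omega
    obtain ⟨k, hkn, hus, hds⟩ : ∃ k ≤ n, u k < s ∧ s ≤ d k := by
      by_contra! hcon
      have hall : ∀ k, k ≤ n → d k < s := fun k => by
        induction k with
        | zero => intro h; exact hcon 0 h (by omega)
        | succ k ih => intro h; exact hcon _ h ((hk k (by omega)).trans (ih (by omega)))
      have h1 := hall n le_rfl
      have h2 := h.d_last
      omega
    refine ⟨⟨u k, h.u_bound hkn⟩, ⟨d k, h.bound k hkn⟩, hus, hds, ?_⟩
    rw [Fin.lt_def, h.apply_d k hkn _ rfl, h.apply_u k hkn _ rfl]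
    exact h.lt k hkn

theorem not_isBreak (h : IsArcsOf π u d) {k : ℕ} (hk : k < n) (hu : u (k + 1) = u k + 1)
    (hd : d (k + 1) = d k + 1) : ¬ IsBreak π (u k) ∧ ¬ IsBreak π (d k) := by
  constructor
  · rintro ⟨a, b, ha, hb, hab⟩
    rw [h.apply_u k hk.le a ha, h.apply_u (k + 1) hk b (by omega)] at hab
    exact hab hd
  · rintro ⟨a, b, ha, hb, hab⟩
    rw [h.apply_d k hk.le a ha, h.apply_d (k + 1) hk b (by omega)] at hab
    exact hab hu

theorem isBreak_u (h : IsArcsOf π u d) {k : ℕ} (hk : k < n)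
    (hne : ¬ (u (k + 1) = u k + 1 ∧ d (k + 1) = d k + 1)) : IsBreak π (u k) := by
  have hk' : k + 1 ≤ n := hk
  have h1 := h.u_lt k (k + 1) (by omega) hk
  have h2 := h.u_bound hk'
  refine ⟨⟨u k, by omega⟩, ⟨u k + 1, by omega⟩, rfl, rfl, fun e => ?_⟩
  rw [h.apply_u k hk.le ⟨u k, by omega⟩ rfl] at e
  rcases h.cover (u k + 1) (by omega) with ⟨l, hl, hl'⟩ | ⟨l, hl, hl'⟩
  · rw [h.apply_u l hl _ hl'.symm] at e
    have h3 := (h.u_lt_iff hk.le hl).mp (by omega)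
    have h4 := h.u_lt_iff hk' hl
    have h5 := h.u_lt_iff hl hk'
    obtain rfl : l = k + 1 := by omega
    exact hne ⟨hl', e⟩
  · rw [h.apply_d l hl _ hl'.symm] at e
    have h3 := h.lt l hl
    have h4 := h.lt k hk.le
    omega

theorem isBreak_d (h : IsArcsOf π u d) {k : ℕ} (hk : k < n)
    (hne : ¬ (u (k + 1) = u k + 1 ∧ d (k + 1) = d k + 1)) : IsBreak π (d k) := by
  have hk' : k + 1 ≤ n := hk
  have h1 := h.d_lt k (k + 1) (by omega) hk
  have h2 := h.bound _ hk'
  refine ⟨⟨d k, by omega⟩, ⟨d k + 1, by omega⟩, rfl, rfl, fun e => ?_⟩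
  rw [h.apply_d k hk.le ⟨d k, by omega⟩ rfl] at e
  rcases h.cover (d k + 1) (by omega) with ⟨l, hl, hl'⟩ | ⟨l, hl, hl'⟩
  · rw [h.apply_u l hl _ hl'.symm] at e
    have h3 := h.lt l hl
    have h4 := h.lt k hk.le
    omega
  · rw [h.apply_d l hl _ hl'.symm] at e
    have h3 := (h.d_lt_iff hk.le hl).mp (by omega)
    have h4 := h.d_lt_iff hk' hl
    have h5 := h.d_lt_iff hl hk'
    obtain rfl : l = k + 1 := by omega
    exact hne ⟨e, hl'⟩

/-- The last opener carries the largest value, so this break is always present. -/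
theorem isBreak_u_last (h : IsArcsOf π u d) : IsBreak π (u n) := by
  have h1 := h.lt n le_rfl
  have h2 := h.bound n le_rfl
  refine ⟨⟨u n, by omega⟩, ⟨u n + 1, by omega⟩, rfl, rfl, fun e => ?_⟩
  rw [h.apply_u n le_rfl ⟨u n, by omega⟩ rfl, h.d_last] at e
  omega

theorem forall_isBreak_iff (h : IsArcsOf π u d) : (∀ i, i + 1 < 2 * n + 2 → IsBreak π i) ↔
    ∀ k < n, ¬ (u (k + 1) = u k + 1 ∧ d (k + 1) = d k + 1) := by
  constructor
  · rintro hb k hk ⟨h1, h2⟩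
    have := h.u_bound (k := k + 1) hk
    have := h.u_lt k (k + 1) (by omega) hk
    exact (h.not_isBreak hk h1 h2).1 (hb _ (by omega))
  · intro hne i hi
    rcases h.cover i (by omega) with ⟨k, hk, rfl⟩ | ⟨k, hk, rfl⟩
    · rcases hk.eq_or_lt with rfl | hk
      · exact h.isBreak_u_last
      · exact h.isBreak_u hk (hne k hk)
    · rcases hk.eq_or_lt with rfl | hk
      · have := h.d_last
        omega
      · exact h.isBreak_d hk (hne k hk)

theorem exists_two_isBreak_iff (h : IsArcsOf π u d) :
    (∃ i j, i < j ∧ IsBreak π i ∧ IsBreak π j) ↔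
      ∃ k < n, ¬ (u (k + 1) = u k + 1 ∧ d (k + 1) = d k + 1) := by
  constructor
  · rintro ⟨i, j, hij, hi, hj⟩
    by_contra! hcon
    have hlast : ∀ i, IsBreak π i → i = u n := fun i hi => by
      have := hi.lt
      rcases h.cover i (by omega) with ⟨k, hk, rfl⟩ | ⟨k, hk, rfl⟩
      · rcases hk.eq_or_lt with rfl | hk
        · rfl
        · exact absurd hi (h.not_isBreak hk (hcon k hk).1 (hcon k hk).2).1
      · rcases hk.eq_or_lt with rfl | hk
        · have := h.d_last
          omega
        · exact absurd hi (h.not_isBreak hk (hcon k hk).1 (hcon k hk).2).2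
    have h1 := hlast i hi
    have h2 := hlast j hj
    omega
  · rintro ⟨k, hk, hne⟩
    exact ⟨u k, d k, h.lt k hk.le, h.isBreak_u hk hne, h.isBreak_d hk hne⟩

end IsArcsOf

/-- A fixed point `i` with some `a < i < π a` would give the pattern 321 at `a`, `i`, `π a`. So no
arc crosses a fixed point, and `π` splits next to it. -/
theorem IsIndecomposable.apply_ne {N : ℕ} {π : Equiv.Perm (Fin N)} (h321 : IsInv321 π)
    (hind : IsIndecomposable π) (hN : 2 ≤ N) (i : Fin N) : π i ≠ i := by
  intro hi
  by_cases h0 : i.val = 0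
  · obtain ⟨a, b, ha, hb, hab⟩ := hind 1 one_pos (by omega)
    obtain rfl : a = i := Fin.ext (by omega)
    rw [hi, Fin.lt_def] at hab
    omega
  · obtain ⟨a, b, ha, hb, hab⟩ := hind i.val (by omega) i.isLt
    have h1 : ∀ a : Fin N, a < i → π a ≤ i := fun a ha => by
      by_contra! hlt
      exact h321.2 ⟨a, i, π a, ha, hlt, by rw [h321.1, hi]; exact ha, by rw [hi]; exact hlt⟩
    have h2 := h1 (π b) (hab.trans_le (h1 a ha))
    rw [h321.1] at h2
    obtain rfl : b = i := Fin.ext (by rw [Fin.le_def] at h2; omega)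
    rw [hi] at hab
    exact absurd (h1 a ha) (not_le.mpr hab)

theorem two_mul_card_openers {N : ℕ} {π : Equiv.Perm (Fin N)} (hinv : ∀ i, π (π i) = i)
    (hne : ∀ i, π i ≠ i) : 2 * (Finset.univ.filter fun i => i < π i).card = N := by
  have h : (Finset.univ.filter fun i => i < π i).map π.toEmbedding =
      Finset.univ.filter fun i => ¬ i < π i := by
    ext i
    simp only [Finset.mem_map, Finset.mem_filter, Finset.mem_univ, true_and,
      Equiv.coe_toEmbedding, not_lt]
    constructor
    · rintro ⟨j, hj, rfl⟩
      rw [hinv]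
      exact hj.le
    · intro hi
      exact ⟨π i, by rw [hinv]; exact lt_of_le_of_ne hi (hne i), hinv i⟩
  have h1 := Finset.card_filter_add_card_filter_not (s := Finset.univ) fun i => i < π i
  rw [← h, Finset.card_map, Finset.card_univ, Fintype.card_fin] at h1
  omega

theorem exists_isArcsOf {n : ℕ} {π : Equiv.Perm (Fin (2 * n + 2))} (h321 : IsInv321 π)
    (hind : IsIndecomposable π) : ∃ u d, IsArcsOf π u d := by
  have hinv := h321.1
  have hne := hind.apply_ne h321 (by omega)
  set O := Finset.univ.filter fun i => i < π i with hO
  have hcard : O.card = n + 1 := by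
    have : 2 * O.card = 2 * n + 2 := two_mul_card_openers hinv hne
    omega
  let f := O.orderEmbOfFin hcard
  have hf : ∀ k, f k < π (f k) := fun k => by
    have := O.orderEmbOfFin_mem hcard k
    exact (Finset.mem_filter.mp this).2
  have hsurj : ∀ i, i < π i → ∃ k, f k = i := fun i hi => by
    have : i ∈ Set.range f := by
      rw [Finset.range_orderEmbOfFin]
      simpa [hO] using hi
    exact this
  -- Two nested arcs would give the pattern 321: the two openers, followed by the closer of the
  -- inner arc.
  have hmono : ∀ j k, j < k → π (f j) < π (f k) := fun j k hjk => by
    by_contra! hle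
    have h1 : f j < f k := f.strictMono hjk
    have h2 := lt_of_le_of_ne hle fun e => h1.ne' (π.injective e)
    exact h321.2 ⟨f j, f k, π (f k), h1, hf k, by rw [hinv]; exact hf k, h2⟩
  let u : ℕ → ℕ := fun k => if h : k < n + 1 then (f ⟨k, h⟩).val else 0
  let d : ℕ → ℕ := fun k => if h : k < n + 1 then (π (f ⟨k, h⟩)).val else 0
  have hu : ∀ k (h : k < n + 1), u k = (f ⟨k, h⟩).val := fun k h => by simp only [u, dif_pos h]
  have hd : ∀ k (h : k < n + 1), d k = (π (f ⟨k, h⟩)).val := fun k h => by simp only [d, dif_pos h]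
  refine ⟨u, d, ⟨fun j k hjk hk => ?_, fun j k hjk hk => ?_, fun k hk => ?_, fun j hj k hk e => ?_,
    fun k hk => ?_, fun p hp => ?_⟩, fun k hk i hi => ?_, fun k hk i hi => ?_⟩
  · rw [hu j (by omega), hu k (by omega)]
    exact f.strictMono (show (⟨j, _⟩ : Fin (n + 1)) < ⟨k, _⟩ from hjk)
  · rw [hd j (by omega), hd k (by omega)]
    exact hmono ⟨j, _⟩ ⟨k, _⟩ hjk
  · rw [hu k (by omega), hd k (by omega)]
    exact hf _
  · rw [hu j (by omega), hd k (by omega)] at e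
    have h1 := hf ⟨j, by omega⟩
    rw [Fin.ext e, hinv] at h1
    exact lt_asymm h1 (hf _)
  · rw [hd k (by omega)]
    exact Fin.isLt _
  · rcases lt_or_gt_of_ne (hne ⟨p, hp⟩) with h | h
    · right
      obtain ⟨k, hk⟩ := hsurj (π ⟨p, hp⟩) (by rw [hinv]; exact h)
      exact ⟨k, by omega, by rw [hd k k.isLt, Fin.eta, hk, hinv]⟩
    · left
      obtain ⟨k, hk⟩ := hsurj ⟨p, hp⟩ h
      exact ⟨k, by omega, by rw [hu k k.isLt, Fin.eta, hk]⟩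
  · rw [hu k (by omega)] at hi
    rw [hd k (by omega), Fin.ext hi]
  · rw [hd k (by omega)] at hi
    rw [hu k (by omega), Fin.ext hi, hinv]

/-! ### The word of an involution -/

/-- The word `w` records which consecutive closers and openers of `π` are not adjacent. -/
def IsWordOf {n : ℕ} (w : Fin n → Bool × Bool) (π : Equiv.Perm (Fin (2 * n + 2))) : Prop :=
  ∃ u d, IsArcsOf π u d ∧ ∀ k (hk : k < n),
    ((w ⟨k, hk⟩).1 = true ↔ d (k + 1) ≠ d k + 1) ∧ ((w ⟨k, hk⟩).2 = true ↔ u (k + 1) ≠ u k + 1)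

theorem isGapCount_trueCount_iff {n : ℕ} {w : Fin n → Bool × Bool} {u d : ℕ → ℕ} :
    IsGapCount n u d (trueCount fun i => (w i).1) (trueCount fun i => (w i).2) ↔
      ∀ k (hk : k < n), ((w ⟨k, hk⟩).1 = true ↔ d (k + 1) ≠ d k + 1) ∧
        ((w ⟨k, hk⟩).2 = true ↔ u (k + 1) ≠ u k + 1) := by
  have key : ∀ (b : Fin n → Bool) (k : ℕ) (hk : k < n) (P : Prop) [Decidable P],
      (trueCount b (k + 1) = trueCount b k + if P then 0 else 1) ↔ (b ⟨k, hk⟩ = true ↔ ¬ P) := by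
    intro b k hk P _
    rw [trueCount_succ b hk]
    by_cases hP : P <;> cases b ⟨k, hk⟩ <;> simp [hP]
  constructor
  · intro h k hk
    exact ⟨(key _ k hk _).mp (h.α_succ k hk), (key _ k hk _).mp (h.β_succ k hk)⟩
  · intro h
    exact ⟨trueCount_zero _, trueCount_zero _, fun k hk => (key _ k hk _).mpr (h k hk).1,
      fun k hk => (key _ k hk _).mpr (h k hk).2⟩

theorem IsWordOf.perm_unique {n : ℕ} {w : Fin n → Bool × Bool}
    {π π' : Equiv.Perm (Fin (2 * n + 2))} (h : IsWordOf w π) (h' : IsWordOf w π') : π = π' := by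
  obtain ⟨u, d, ha, hw⟩ := h
  obtain ⟨u', d', ha', hw'⟩ := h'
  exact ha.perm_unique ha' fun k hk => (isGapCount_trueCount_iff.mpr hw).unique ha.toIsArcSystem
    (isGapCount_trueCount_iff.mpr hw') ha'.toIsArcSystem hk

theorem IsWordOf.word_unique {n : ℕ} {w w' : Fin n → Bool × Bool}
    {π : Equiv.Perm (Fin (2 * n + 2))} (h : IsWordOf w π) (h' : IsWordOf w' π) : w = w' := by
  obtain ⟨u, d, ha, hw⟩ := h
  obtain ⟨u', d', ha', hw'⟩ := h'
  funext ⟨k, hk⟩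
  have h1 := ha.arcs_unique ha' (show k ≤ n by omega)
  have h2 := ha.arcs_unique ha' (show k + 1 ≤ n from hk)
  have h3 := hw k hk
  rw [h1.1, h1.2, h2.1, h2.2] at h3
  exact Prod.ext (Bool.eq_iff_iff.mpr (h3.1.trans (hw' k hk).1.symm))
    (Bool.eq_iff_iff.mpr (h3.2.trans (hw' k hk).2.symm))

theorem exists_isWordOf_of_perm {n : ℕ} {π : Equiv.Perm (Fin (2 * n + 2))} (h321 : IsInv321 π)
    (hind : IsIndecomposable π) : ∃ w ∈ levelWords 1 n 0, IsWordOf w π := by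
  obtain ⟨u, d, ha⟩ := exists_isArcsOf h321 hind
  let w : Fin n → Bool × Bool := fun k =>
    (decide (d (k.val + 1) ≠ d k.val + 1), decide (u (k.val + 1) ≠ u k.val + 1))
  have hw : ∀ k (hk : k < n), ((w ⟨k, hk⟩).1 = true ↔ d (k + 1) ≠ d k + 1) ∧
      ((w ⟨k, hk⟩).2 = true ↔ u (k + 1) ≠ u k + 1) := fun k hk =>
    ⟨decide_eq_true_iff, decide_eq_true_iff⟩
  have hg := isGapCount_trueCount_iff.mpr hw
  exact ⟨w, ⟨fun k hk => (hg.u_lt_d_iff ha.toIsArcSystem hk hk.le).mp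
    (ha.isIndecomposable_iff.mp hind k hk), hg.α_last_eq ha.toIsArcSystem, by simp⟩, u, d, ha, hw⟩

theorem exists_isWordOf_of_word {n : ℕ} {w : Fin n → Bool × Bool} (hw : w ∈ levelWords 1 n 0) :
    ∃ π, (IsInv321 π ∧ IsIndecomposable π) ∧ IsWordOf w π := by
  obtain ⟨h1, h2, -⟩ := hw
  set α := trueCount fun i => (w i).1 with hα
  set β := trueCount fun i => (w i).2 with hβ
  have hαm : Monotone α := trueCount_mono _
  have hβm : Monotone β := trueCount_mono _
  have hg : IsGapCount n (openerOf n α β) (closerOf n α β) α β :=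
    isGapCount_of hαm hβm (trueCount_zero _) (trueCount_zero _) (trueCount_succ_le _)
      (trueCount_succ_le _) h2
  have ha : IsArcSystem n (openerOf n α β) (closerOf n α β) :=
    isArcSystem_of_monotone hαm hβm fun k hk => by
      rcases hk.eq_or_lt with rfl | hk
      · exact h2.ge
      · exact (hβm (Nat.le_succ k)).trans (h1 k hk)
  obtain ⟨π, hπ⟩ := ha.exists_perm
  exact ⟨π, ⟨hπ.isInv321, hπ.isIndecomposable_iff.mpr fun k hk =>
    (hg.u_lt_d_iff ha hk hk.le).mpr (h1 k hk)⟩, _, _, hπ, isGapCount_trueCount_iff.mp hg⟩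

theorem IsWordOf.letter_eq_iff {n : ℕ} {w : Fin n → Bool × Bool} {u d : ℕ → ℕ}
    (hw : ∀ k (hk : k < n), ((w ⟨k, hk⟩).1 = true ↔ d (k + 1) ≠ d k + 1) ∧
        ((w ⟨k, hk⟩).2 = true ↔ u (k + 1) ≠ u k + 1)) {k : ℕ} (hk : k < n) :
    w ⟨k, hk⟩ = (false, false) ↔ (u (k + 1) = u k + 1 ∧ d (k + 1) = d k + 1) := by
  obtain ⟨h1, h2⟩ := hw k hk
  rw [Prod.ext_iff, Bool.eq_false_iff, Bool.eq_false_iff, ne_eq, ne_eq, h1, h2]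
  tauto

theorem IsWordOf.forall_isBreak_iff {n : ℕ} {w : Fin n → Bool × Bool}
    {π : Equiv.Perm (Fin (2 * n + 2))} (h : IsWordOf w π) :
    (∀ i, i + 1 < 2 * n + 2 → IsBreak π i) ↔ ∀ i, w i ≠ (false, false) := by
  obtain ⟨u, d, ha, hw⟩ := h
  rw [ha.forall_isBreak_iff]
  exact ⟨fun h i e => h i i.isLt ((IsWordOf.letter_eq_iff hw i.isLt).mp e),
    fun h k hk e => h ⟨k, hk⟩ ((IsWordOf.letter_eq_iff hw hk).mpr e)⟩

theorem IsWordOf.exists_two_isBreak_iff {n : ℕ} {w : Fin n → Bool × Bool}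
    {π : Equiv.Perm (Fin (2 * n + 2))} (h : IsWordOf w π) :
    (∃ i j, i < j ∧ IsBreak π i ∧ IsBreak π j) ↔ w ≠ fun _ => (false, false) := by
  obtain ⟨u, d, ha, hw⟩ := h
  rw [ha.exists_two_isBreak_iff, Function.ne_iff]
  constructor
  · rintro ⟨k, hk, h⟩
    exact ⟨⟨k, hk⟩, fun e => h ((IsWordOf.letter_eq_iff hw hk).mp e)⟩
  · rintro ⟨i, h⟩
    exact ⟨i, i.isLt, fun e => h ((IsWordOf.letter_eq_iff hw i.isLt).mpr e)⟩

/-! ### Counting and the main theorem -/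

theorem ncard_eq_of_rel {α β : Type*} {S : Set α} {T : Set β} (R : α → β → Prop)
    (hS : ∀ a ∈ S, ∃ b ∈ T, R a b) (hT : ∀ b ∈ T, ∃ a ∈ S, R a b)
    (hl : ∀ a a' b, R a b → R a' b → a = a') (hr : ∀ a b b', R a b → R a b' → b = b') :
    S.ncard = T.ncard := by
  choose f hfT hfR using hS
  refine Set.ncard_congr f hfT (fun a b ha hb e => ?_) fun b hb => ?_
  · exact hl a b _ (hfR a ha) (e ▸ hfR b hb)
  · obtain ⟨a, ha, hab⟩ := hT b hb
    exact ⟨a, ha, hr a _ _ (hfR a ha) hab⟩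

theorem ncard_simpleInv321 {n : ℕ} (hn : 1 ≤ n) :
    (simpleInv321 (2 * n + 2)).ncard = pathCount 0 n 0 := by
  rw [← ncard_levelWords (by omega)]
  refine ncard_eq_of_rel (fun π w => IsWordOf w π) (fun π hπ => ?_) (fun w hw => ?_)
    (fun _ _ _ => IsWordOf.perm_unique) fun _ _ _ => IsWordOf.word_unique
  · obtain ⟨-, h1, h2, h3⟩ := mem_simpleInv321_iff.mp hπ
    obtain ⟨w, ⟨hw1, hw2, -⟩, hwπ⟩ := exists_isWordOf_of_perm h1 h2
    exact ⟨w, ⟨hw1, hw2, fun _ => hwπ.forall_isBreak_iff.mp h3⟩, hwπ⟩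
  · obtain ⟨hw1, hw2, hw3⟩ := hw
    obtain ⟨π, ⟨h1, h2⟩, hwπ⟩ := exists_isWordOf_of_word (w := w) ⟨hw1, hw2, by simp⟩
    exact ⟨π, mem_simpleInv321_iff.mpr ⟨by omega, h1, h2, hwπ.forall_isBreak_iff.mpr (hw3 rfl)⟩,
      hwπ⟩

theorem ncard_simple_union_inflated {n : ℕ} (hn : 1 ≤ n) :
    (simpleInv321 (2 * n + 2) ∪ inflatedInv321 (2 * n + 2)).ncard + 1 = pathCount 1 n 0 := by
  have hmem : (fun _ => (false, false)) ∈ levelWords 1 n 0 := by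
    have h0 : ∀ k, trueCount (fun _ : Fin n => false) k = 0 := fun k => by
      rw [trueCount, Nat.count_iff_forall_not]
      simp
    exact ⟨fun k _ => by simp only [h0, le_refl], by simp only [h0, add_zero], by simp⟩
  -- The removed word has only bonds; its involution has a single break, at the last opener.
  rw [← ncard_levelWords le_rfl, ← Set.ncard_sdiff_singleton_add_one hmem]
  congr 1
  refine ncard_eq_of_rel (fun π w => IsWordOf w π) (fun π hπ => ?_) (fun w hw => ?_)
    (fun _ _ _ => IsWordOf.perm_unique) fun _ _ _ => IsWordOf.word_unique
  · obtain ⟨-, h1, h2, h3⟩ := mem_simple_union_inflated_iff.mp hπ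
    obtain ⟨w, hw, hwπ⟩ := exists_isWordOf_of_perm h1 h2
    exact ⟨w, ⟨hw, hwπ.exists_two_isBreak_iff.mp h3⟩, hwπ⟩
  · obtain ⟨π, ⟨h1, h2⟩, hwπ⟩ := exists_isWordOf_of_word hw.1
    exact ⟨π, mem_simple_union_inflated_iff.mpr
      ⟨by omega, h1, h2, hwπ.exists_two_isBreak_iff.mpr hw.2⟩, hwπ⟩

theorem even_of_isIndecomposable {N : ℕ} {π : Equiv.Perm (Fin N)} (hN : 2 ≤ N)
    (h321 : IsInv321 π) (hind : IsIndecomposable π) : Even N := by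
  rw [← two_mul_card_openers h321.1 (hind.apply_ne h321 hN)]
  exact even_two_mul _

theorem simple_union_inflated_eq_empty {N : ℕ} (h : ¬ (2 < N ∧ Even N)) :
    simpleInv321 N ∪ inflatedInv321 N = ∅ := by
  refine Set.eq_empty_of_forall_notMem fun π hπ => h ?_
  obtain ⟨h1, h2, h3, -⟩ := mem_simple_union_inflated_iff.mp hπ
  exact ⟨h1, even_of_isIndecomposable h1.le h2 h3⟩

theorem coeff_gammaGF_add_deltaGF (N : ℕ) : coeff N (gammaGF + deltaGF) =
    ((simpleInv321 N ∪ inflatedInv321 N).ncard : ℚ) := by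
  rw [map_add, gammaGF, deltaGF, permGenFun, permGenFun, coeff_mk, coeff_mk,
    Set.ncard_union_eq (simpleInv321_disjoint_inflatedInv321 N) (Set.toFinite _) (Set.toFinite _)]
  push_cast
  rfl

theorem eq_subst_sq_of_coeff {f g : ℚ⟦X⟧} (h0 : ∀ k, ¬ Even k → coeff k f = 0)
    (h : ∀ k, coeff (2 * k) f = coeff k g) : f = g.subst (X ^ 2 : ℚ⟦X⟧) := by
  ext k
  rw [coeff_subst_X_pow two_ne_zero]
  split_ifs with hk
  · obtain ⟨m, rfl⟩ := hk
    rw [h, Nat.mul_div_cancel_left _ two_pos]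
    rfl
  · exact h0 k (fun he => hk he.two_dvd)

theorem gammaGF_eq : gammaGF = gammaHalf.subst (X ^ 2 : ℚ⟦X⟧) := by
  have hempty : ∀ N, ¬ (2 < N ∧ Even N) → coeff N gammaGF = 0 := fun N hN => by
    have := simple_union_inflated_eq_empty hN
    rw [gammaGF, permGenFun, coeff_mk, (Set.union_empty_iff.mp this).1, Set.ncard_empty,
      Nat.cast_zero]
  refine eq_subst_sq_of_coeff (fun k hk => hempty k fun h => hk h.2) fun k => ?_
  match k with
  | 0 => rw [hempty _ (by simp)]; simp [gammaHalf]
  | 1 => rw [hempty _ (by simp), coeff_gammaHalf_succ]; simp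
  | k + 2 =>
    rw [coeff_gammaHalf_succ, if_neg (by omega), ← ncard_simpleInv321 (by omega), gammaGF,
      permGenFun, coeff_mk]
    rfl

theorem gammaGF_add_deltaGF_eq : gammaGF + deltaGF = zetaHalf.subst (X ^ 2 : ℚ⟦X⟧) := by
  have hempty : ∀ N, ¬ (2 < N ∧ Even N) → coeff N (gammaGF + deltaGF) = 0 := fun N hN => by
    rw [coeff_gammaGF_add_deltaGF, simple_union_inflated_eq_empty hN, Set.ncard_empty,
      Nat.cast_zero]
  refine eq_subst_sq_of_coeff (fun k hk => hempty k fun h => hk h.2) fun k => ?_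
  match k with
  | 0 => rw [hempty _ (by simp)]; simp [zetaHalf]
  -- In length 2 the empty word is itself the removed all-bond word, so the coefficient is `1 - 1`.
  | 1 => rw [hempty _ (by simp), coeff_zetaHalf_succ]; simp [pathCount]
  | k + 2 =>
    rw [coeff_gammaGF_add_deltaGF, coeff_zetaHalf_succ,
      ← ncard_simple_union_inflated (show 1 ≤ k + 1 by omega)]
    push_cast
    rw [add_sub_cancel_right]
    rfl

theorem coeff_gammaGF_two_mul_add_two {n : ℕ} (hn : 1 ≤ n) :
    coeff (2 * n + 2) gammaGF = (pathCount 0 n 0 : ℚ) := by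
  rw [gammaGF, permGenFun, coeff_mk, ncard_simpleInv321 hn]

theorem coeff_gammaGF_ne_zero_iff (k : ℕ) : coeff k gammaGF ≠ 0 ↔ Even k ∧ 6 ≤ k := by
  by_cases hk : 2 < k ∧ Even k
  · obtain ⟨n, hn, rfl⟩ : ∃ n, 1 ≤ n ∧ k = 2 * n + 2 := by
      obtain ⟨m, hm⟩ := hk.2
      exact ⟨m - 1, by omega, by omega⟩
    rw [coeff_gammaGF_two_mul_add_two hn, Nat.cast_ne_zero, pathCount_zero_ne_zero_iff]
    exact ⟨fun h => ⟨hk.2, by omega⟩, fun h => by omega⟩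
  · have := simple_union_inflated_eq_empty hk
    rw [gammaGF, permGenFun, coeff_mk, (Set.union_empty_iff.mp this).1]
    simp only [Set.ncard_empty, Nat.cast_zero, ne_eq, not_true_eq_false, false_iff]
    exact fun h => hk ⟨by omega, h.1⟩

theorem mainTheorem3 :
    -- the square root of `1 - 2x² - 3x⁴` with constant term `1` exists and is unique
    (∃! s : ℚ⟦X⟧, constantCoeff s = 1 ∧ s ^ 2 = 1 - 2 * X ^ 2 - 3 * X ^ 4) ∧
    -- closed form of `γ`
    (∀ s : ℚ⟦X⟧, constantCoeff s = 1 → s ^ 2 = 1 - 2 * X ^ 2 - 3 * X ^ 4 →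
      gammaGF = (1 - X ^ 2 - 2 * X ^ 4 - s) * (2 * (1 + X ^ 2))⁻¹) ∧
    -- `γ` is algebraic over `ℚ[x]`, with the explicit equation
    IsAlgebraic ℚ[X] gammaGF ∧
    (1 + X ^ 2) * gammaGF ^ 2 + (-1 + X ^ 2 + 2 * X ^ 4) * gammaGF + X ^ 6 = 0 ∧
    -- the nonzero coefficients are the Riordan numbers
    (∀ k : ℕ, coeff k gammaGF ≠ 0 ↔ Even k ∧ 6 ≤ k) ∧
    (∀ n : ℕ, 1 ≤ n → coeff (2 * n + 2) gammaGF = (riordanNumber n : ℚ)) ∧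
    -- `γ` and `ζ = γ + δ` are series `g`, `z` in `x²`, related by substitutions
    (∃ g z : ℚ⟦X⟧, gammaGF = g.subst (X ^ 2 : ℚ⟦X⟧) ∧
      gammaGF + deltaGF = z.subst (X ^ 2 : ℚ⟦X⟧) ∧
      z.subst (X ^ 2 : ℚ⟦X⟧) = g.subst (X ^ 2 * (1 - X ^ 2)⁻¹ : ℚ⟦X⟧) ∧
      g.subst (X ^ 2 : ℚ⟦X⟧) = z.subst (X ^ 2 * (1 + X ^ 2)⁻¹ : ℚ⟦X⟧)) := by
  have hq : (1 + X ^ 2) * gammaGF ^ 2 + (-1 + X ^ 2 + 2 * X ^ 4) * gammaGF + X ^ 6 = 0 := by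
    rw [gammaGF_eq]; exact gammaHalf_subst_quadratic
  have h0 : constantCoeff gammaGF = 0 := by
    rw [gammaGF_eq]; exact constantCoeff_gammaHalf_subst
  obtain ⟨s, hs1, hs2, hs3⟩ := exists_sqrt_of_quadratic h0 hq
  refine ⟨⟨s, ⟨hs1, hs2⟩, fun t ht => eq_of_sq_eq_sq ht.1 hs1 (ht.2.trans hs2.symm)⟩,
    fun t ht1 ht2 => ?_, isAlgebraic_of_quadratic hq, hq, coeff_gammaGF_ne_zero_iff,
    fun n hn => ?_, gammaHalf, zetaHalf, gammaGF_eq, gammaGF_add_deltaGF_eq, zeta_substitution,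
    gamma_substitution⟩
  · rw [eq_of_sq_eq_sq ht1 hs1 (ht2.trans hs2.symm)]
    exact hs3
  · rw [coeff_gammaGF_two_mul_add_two hn, riordanNumber_eq_pathCount]
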